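/- **Models.** An algorithm is a nested-parallel program (sequential composition and parallel loops of straight-line strands) over a word-addressed memory of complex numbers. A strand loads words one after another, multiplies each by a root of unity, accumulates the products in one register, and stores the result in one word; loop counters and the recursion stack are not in the addressed memory. In the *depth*, a store costs $\omega$ and every other instruction costs $1$ (a summand takes four instructions: obtaining the root of unity, load, multiplication, addition), sequential composition adds, and the depth of a parallel loop is the maximum over its iterates. Reads and writes are counted on the *Asymmetric Ideal-Cache* for the sequential order of the program: the memory is divided into blocks of $B$ words, an initially empty cache holds at most $\lfloor M/B\rfloor$ blocks, a reference to a non-resident block costs one block read, evicting a block that was modified since it was loaded costs one block write (blocks still dirty at the end are written back), and the offline eviction policy minimizes (reads) $+\ \omega\,\cdot$ (writes). **Algorithm.** Let $\omega\ge 2$ be a power of $2$, and let $n$ be such that the size at every level of the following recursion is a power of $2$. The algorithm $\mathrm{FFT}_\omega(n)$ knows $\omega$ but neither $M$ nor $B$; it works in place on an array of $n$ words, with $n$ further words of workspace. If $n\le\omega$, compute the DFT by brute force. Otherwise put $m=\sqrt{n/\omega}$ and view the input as an $\omega m\times m$ matrix in row-major order. 1. Transpose the matrix. 2. On each row $r$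 of length $\omega m$ (in parallel), viewed as an $\omega\times m$ matrix, compute a DFT: lay out the columns contiguously; replace each column by its $\omega$-point DFT computed by brute force ($\omega$ loads and one store per value); multiply entry $(i,j)$ by $e^{-2\pi\mathrm{i}\,ij/(\omega m)}$; recursively compute the FFT of each of the $\omega$ rows of length $m$ (in parallel); multiply entry $(i,j)$ by the outer twiddle factor $e^{-2\pi\mathrm{i}\,r(i+\omega j)/n}$; transpose the $\omega\times m$ matrix. 3. Transpose the matrix. 4. Recursively compute the FFT of each of the $\omega m$ rows of length $m$ (in parallel). 5. Transpose to the final order. All transpositions are the cache-oblivious ones that split the longer side in half recursively. **Claim.** For all such $\omega$ and $n$: * The program is free of races and computes the DFT: the output is $y_k=\sum_{j<n}x_j e^{-2\pi\mathrm{i}\,jk/n}$ for $0\le k<n$, for every input $x$ and whatever the initial contents of the workspace. * Its depth is $O(\omega\log n\log\log n)$ for $n\ge 4$, with an absolute constant. * Under the tall-cache assumption $M\ge cB^2$ with $c>0$ and $1\le B\le M$, if $n\ge M$ it uses $O\big((\omega n/B)\log_{\omega M}(\omega n)\big)$ block reads and $O\big((n/B)\log_{\omega M}(\omega n)\big)$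 block writes, and if $n\le M$ it uses $O(\omega\lceil n/B\rceil)$ block reads and $O(\lceil n/B\rceil)$ block writes; the constants depend only on $c$. -/

import Mathlib

namespace AsymFFT

/-! ### Nested-parallel programs over a word-addressed memory of complex numbers -/

/-- The summand `exp (-2πi · num / den) * mem[addr]`. -/
structure Term where
  num : ℕ
  den : ℕ
  addr : ℕ

/-- Nested-parallel programs.

* `comb dst ts` is a sequential strand with one accumulator register: for each `t` in `ts`, in
  order, it loads `mem[t.addr]`, multiplies it by the root of unity of `t` and adds the product to
  the register; then it stores the register into `mem[dst]`.
* `seq p q` runs `p`, then `q`.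
* `parFor k body` is a parallel loop with iterates `body 0, …, body (k - 1)`.

Addresses never depend on the data. Loop counters and the recursion stack live outside the
addressed memory. -/
inductive Prog where
  | comb (dst : ℕ) (ts : List Term)
  | seq (p q : Prog)
  | parFor (k : ℕ) (body : ℕ → Prog)

/-- One memory reference. -/
structure Access where
  isWrite : Bool
  addr : ℕ

noncomputable def Term.value (t : Term) (mem : ℕ → ℂ) : ℂ :=
  Complex.exp (-2 * Real.pi * Complex.I * (t.num : ℂ) / (t.den : ℂ)) * mem t.addr

/-- The memory after running a program in its sequential order (each parallel loop is run as a
sequential loop). -/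
noncomputable def Prog.exec : Prog → (ℕ → ℂ) → (ℕ → ℂ)
  | .comb dst ts, mem => Function.update mem dst (ts.map fun t => t.value mem).sum
  | .seq p q, mem => q.exec (p.exec mem)
  | .parFor k body, mem => (List.range k).foldl (fun s i => (body i).exec s) mem

/-- The memory references of a program, in its sequential order. -/
def Prog.trace : Prog → List Access
  | .comb dst ts => ts.map (fun t => ⟨false, t.addr⟩) ++ [⟨true, dst⟩]
  | .seq p q => p.trace ++ q.trace
  | .parFor k body => (List.range k).flatMap fun i => (body i).trace

/-- The depth: the cost of the longest chain of dependences, where a store costs `ω` and every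
other instruction costs `1`. A summand of `comb` takes four instructions (obtain the root of unity,
load, multiply, add). The depth of a parallel loop is the maximum over its iterates. -/
def Prog.depth (ω : ℕ) : Prog → ℕ
  | .comb _ ts => 4 * ts.length + ω
  | .seq p q => p.depth ω + q.depth ω
  | .parFor k body => (Finset.range k).sup fun i => (body i).depth ω

/-- Distinct iterates of a parallel loop never touch a location that one of them writes (concurrent
reads are allowed), so every parallel schedule has the same effect as the sequential order. -/
def Prog.RaceFree : Prog → Prop
  | .comb _ _ => True
  | .seq p q => p.RaceFree ∧ q.RaceFree
  | .parFor k body =>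
      (∀ i < k, (body i).RaceFree) ∧
      ∀ i < k, ∀ j < k, i ≠ j → ∀ x b,
        (⟨true, x⟩ : Access) ∈ (body i).trace → (⟨b, x⟩ : Access) ∉ (body j).trace

/-! ### The asymmetric ideal cache -/

/-- `CacheRun cap C D l r w`: a cache holding at most `cap` blocks, currently holding the blocks
`C` of which those in `D` are dirty, can serve the block references `l` with `r` block reads and
`w` block writes, for some choice of evictions. A reference to a resident block is free, a miss
costs one read, evicting a dirty block costs one write, evicting a clean one is free. The blocks
that are still dirty at the end are written back. -/
inductive CacheRun (cap : ℕ) : Finset ℕ → Finset ℕ → List Access → ℕ → ℕ → Prop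
  | done (C D : Finset ℕ) : CacheRun cap C D [] 0 D.card
  | hit {C D : Finset ℕ} {x : Access} {l : List Access} {r w : ℕ} (hx : x.addr ∈ C)
      (h : CacheRun cap C (if x.isWrite then insert x.addr D else D) l r w) :
      CacheRun cap C D (x :: l) r w
  | miss {C D : Finset ℕ} {x : Access} {l : List Access} {r w : ℕ} (hx : x.addr ∉ C)
      (hC : C.card < cap)
      (h : CacheRun cap (insert x.addr C) (if x.isWrite then insert x.addr D else D) l r w) :
      CacheRun cap C D (x :: l) (r + 1) w
  | evict {C D : Finset ℕ} {v : ℕ} {l : List Access} {r w : ℕ} (hv : v ∈ C)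
      (h : CacheRun cap (C.erase v) (D.erase v) l r w) :
      CacheRun cap C D l r (w + if v ∈ D then 1 else 0)

/-- The block references of `p` for block size `B`: the location `x` lies in block `x / B`. -/
def Prog.blockTrace (B : ℕ) (p : Prog) : List Access :=
  p.trace.map fun x => ⟨x.isWrite, x.addr / B⟩

/-- An optimal offline replacement policy for `p`, on a cache of `M` words in blocks of `B` words
that is initially empty, makes `r` block reads and `w` block writes: no policy has a total cost
smaller than `r + ω * w`. -/
def IdealCost (ω M B : ℕ) (p : Prog) (r w : ℕ) : Prop :=
  CacheRun (M / B) ∅ ∅ (p.blockTrace B) r w ∧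
  ∀ r' w', CacheRun (M / B) ∅ ∅ (p.blockTrace B) r' w' → r + ω * w ≤ r' + ω * w'

/-! ### The algorithm -/

/-- Two programs in parallel. -/
def par (p q : Prog) : Prog := .parFor 2 fun i => if i = 0 then p else q

/-- Copy `k` consecutive words from `s` to `d`. -/
def copy (k s d : ℕ) : Prog := .parFor k fun i => .comb (d + i) [⟨0, 1, s + i⟩]

/-- Cache-oblivious transposition of the `p × q` matrix at `s` (row-major with row stride `ss`)
into the `q × p` matrix at `d` (row-major with row stride `ds`): split the longer side in half and
treat the two halves in parallel. -/
def transpose (p q s ss d ds : ℕ) : Prog :=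
  if p = 0 ∨ q = 0 then copy 0 s d
  else if p = 1 ∧ q = 1 then copy 1 s d
  else if q ≤ p then
    par (transpose (p / 2) q s ss d ds)
      (transpose (p - p / 2) q (s + p / 2 * ss) ss (d + p / 2) ds)
  else
    par (transpose p (q / 2) s ss d ds)
      (transpose p (q - q / 2) (s + q / 2) ss (d + q / 2 * ds) ds)
termination_by p + q
decreasing_by all_goals omega

/-- Brute-force `k`-point DFTs of `m` vectors. Vector `j` occupies the `k` consecutive words from
`s + j * k`; entry `i'` of its DFT goes to row `i'`, column `j` of the `k × m` row-major matrix at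
`d`. Each value takes `k` loads and one store. -/
def bruteDFT (k m s d : ℕ) : Prog :=
  .parFor k fun i' => .parFor m fun j =>
    .comb (d + i' * m + j) ((List.range k).map fun i => ⟨i * i', k, s + j * k + i⟩)

/-- Multiply entry `(i, j)` of the `k × m` row-major matrix at `s` by `exp (-2πi · e i j / N)`. -/
def twiddle (k m N : ℕ) (e : ℕ → ℕ → ℕ) (s : ℕ) : Prog :=
  .parFor k fun i => .parFor m fun j => .comb (s + i * m + j) [⟨e i j, N, s + i * m + j⟩]

/-- The modified Cooley–Tukey FFT of the `n` words from `a`, in place, with the `n` words from `t`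
as workspace. It knows `ω`, but neither the cache size nor the block size. With `m = √(n/ω)` the
input is an `ω m × m` row-major matrix:

1. transpose it;
2. on each row `r` (of length `ω m`, viewed as an `ω × m` matrix), compute a DFT: lay the columns
   out contiguously, replace them by their brute-force `ω`-point DFTs, apply the twiddle factors of
   the `ω × m` factorisation, recursively transform the `ω` rows of length `m`, apply the twiddle
   factors of the outer `ω m × m` factorisation, and transpose the `ω × m` matrix;
3. transpose;
4. recursively transform each of the `ω m` rows of length `m`;
5. transpose to the final order.

For `n ≤ ω` the DFT is computed by brute force. -/
def fft (ω n a t : ℕ) : Prog :=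
  if _h : n ≤ ω then .seq (bruteDFT n 1 a t) (copy n t a)
  else
    let m := Nat.sqrt (n / ω)
    let l := ω * m
    .seq (transpose l m a m t l) <|
    .seq (.parFor m fun r =>
      .seq (transpose ω m (t + r * l) m (a + r * l) ω) <|
      .seq (bruteDFT ω m (a + r * l) (t + r * l)) <|
      .seq (twiddle ω m l (fun i j => i * j) (t + r * l)) <|
      .seq (.parFor ω fun i => fft ω m (t + r * l + i * m) (a + r * l + i * m)) <|
      .seq (twiddle ω m n (fun i j => r * (i + ω * j)) (t + r * l)) <|
      transpose ω m (t + r * l) m (a + r * l) ω) <|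
    .seq (transpose m l a l t m) <|
    .seq (.parFor l fun k => fft ω m (t + k * m) (a + k * m)) <|
    transpose l m t m a l
termination_by n
decreasing_by
  all_goals
    have h1 : n / ω ≤ n := Nat.div_le_self n ω
    have h2 : Nat.sqrt (n / ω) < n := by
      rcases Nat.lt_or_ge (n / ω) 2 with h3 | h3
      · rcases Nat.eq_zero_or_pos ω with h4 | h4
        · subst h4
          simp
          omega
        · have := Nat.sqrt_le_self (n / ω)
          omega
      · have := Nat.sqrt_lt_self (n := n / ω) (by omega)
        omega
    exact h2

/-- The input sizes on which the size at each level of the recursion is a power of two (for `ω`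
a power of two): the recursion goes from `n = ω m²` to `m = √(n/ω)` and ends at sizes `≤ ω`. -/
inductive FFTSize (ω : ℕ) : ℕ → Prop
  | base (e : ℕ) (h : 2 ^ e ≤ ω) : FFTSize ω (2 ^ e)
  | step (m : ℕ) (h : FFTSize ω m) : FFTSize ω (ω * m ^ 2)

end AsymFFT

/-! Correctness. Write an input index as `u = i * q + j` and an output index as `i' + p * j'`. In
the product of the two, the multiple of `p * q` disappears from the root of unity, and a DFT of
length `p * q` splits into DFTs of length `p`, twiddle factors and DFTs of length `q`
(`cooleyTukey`). The algorithm uses this with factors `ω m` and `m` on the whole array and with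
factors `ω` and `m` inside each row. Every recursive call stays within its own stretch of array and
workspace (`within_fft`). The iterates of the outer loops are therefore disjoint, and each iterate
of a race-free loop can be evaluated as if it ran alone (`Prog.exec_parFor_apply`).

Depth. Forks are free, so a transposition has depth `O(ω)` and the depth satisfies `D(ω m²) ≤ 2 D(m)
+ 26 ω`. Since `log (ω m²) = log ω + 2 log m` and `log₂ ω ≥ 1`, this solves to `O(ω log n)`; for `n
≥ 4` the factor `log log n` is at least `1`.

Cache. An optimal policy costs no more than any policy that can be exhibited, and one bound `r + ω w
≤ ω x` yields both `r ≤ ω x` and `w ≤ x`. The exhibited policies cut the trace into pieces that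
start and end with an empty cache (`CostLE`), so that costs add. A piece touching few blocks loads
each of them once (`CostAt.phase`); a scan keeps one block for reading and one for writing
(`CostAt.heads`). A brute-force DFT sweeps its input up to `ω` times but writes only once, so it
costs `O(ω N / B)` up to an additive `O(ω)`, like the twiddle factors and, in a tall cache, the
transpositions.

A problem of size `n = ω m²` that does not fit into the cache thus costs `O(ω n / B)` plus two
generations of `ω m` subproblems of size `m`. The quantity `X n = log_{ω M} (ω n)` doubles from `m`
to `n` and is bounded below on problems that do not fit, so the total is `O(ω (n / B) X n)`.
Subproblems may be shorter than a block. The induction (`cost_fftLoop`) is therefore about loops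
over contiguous subproblems, of total length at least `κ B`, and those that fit into the cache are
served in groups (`cost_parFor_of_fits`). -/

namespace AsymFFT

/-! ### Locations read and written by a program -/

/-- The locations read by a program, in its sequential order. -/
def Prog.reads : Prog → List ℕ
  | .comb _ ts => ts.map Term.addr
  | .seq p q => p.reads ++ q.reads
  | .parFor k body => (List.range k).flatMap fun i => (body i).reads

/-- The locations written by a program, in its sequential order. -/
def Prog.writes : Prog → List ℕ
  | .comb dst _ => [dst]
  | .seq p q => p.writes ++ q.writes
  | .parFor k body => (List.range k).flatMap fun i => (body i).writes

theorem Prog.mem_trace_true {p : Prog} {x : ℕ} :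
    (⟨true, x⟩ : Access) ∈ p.trace ↔ x ∈ p.writes := by
  induction p with
  | comb dst ts => simp [trace, writes]
  | seq p q hp hq => simp [trace, writes, hp, hq]
  | parFor k body ih => simp [trace, writes, ih]

theorem Prog.mem_trace_false {p : Prog} {x : ℕ} :
    (⟨false, x⟩ : Access) ∈ p.trace ↔ x ∈ p.reads := by
  induction p with
  | comb dst ts => simp [trace, reads]
  | seq p q hp hq => simp [trace, reads, hp, hq]
  | parFor k body ih => simp [trace, reads, ih]

theorem Prog.raceFree_parFor {k : ℕ} {body : ℕ → Prog} :
    (Prog.parFor k body).RaceFree ↔ (∀ i < k, (body i).RaceFree) ∧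
      ∀ i < k, ∀ j < k, i ≠ j → ∀ x ∈ (body i).writes,
        x ∉ (body j).reads ∧ x ∉ (body j).writes := by
  simp only [RaceFree, Bool.forall_bool, mem_trace_true, mem_trace_false]
  grind

theorem Prog.mem_writes_parFor {k : ℕ} {body : ℕ → Prog} {x : ℕ} :
    x ∈ (Prog.parFor k body).writes ↔ ∃ i < k, x ∈ (body i).writes := by
  simp [writes]

theorem Prog.mem_reads_parFor {k : ℕ} {body : ℕ → Prog} {x : ℕ} :
    x ∈ (Prog.parFor k body).reads ↔ ∃ i < k, x ∈ (body i).reads := by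
  simp [reads]

theorem Prog.mem_writes_seq {p q : Prog} {x : ℕ} :
    x ∈ (Prog.seq p q).writes ↔ x ∈ p.writes ∨ x ∈ q.writes := by
  simp [writes]

theorem Prog.mem_reads_seq {p q : Prog} {x : ℕ} :
    x ∈ (Prog.seq p q).reads ↔ x ∈ p.reads ∨ x ∈ q.reads := by
  simp [reads]

theorem Prog.exec_parFor_succ (k : ℕ) (body : ℕ → Prog) (mem : ℕ → ℂ) :
    (Prog.parFor (k + 1) body).exec mem = (body k).exec ((Prog.parFor k body).exec mem) := by
  simp [exec, List.range_succ]

/-- A program leaves the locations that it does not write unchanged. -/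
theorem Prog.exec_of_notMem_writes {p : Prog} {mem : ℕ → ℂ} {x : ℕ} (h : x ∉ p.writes) :
    p.exec mem x = mem x := by
  induction p generalizing mem with
  | comb dst ts =>
    simp only [writes, List.mem_singleton] at h
    simp [exec, h]
  | seq p q hp hq =>
    rw [mem_writes_seq, not_or] at h
    rw [exec, hq h.2, hp h.1]
  | parFor k body ih =>
    induction k with
    | zero => rfl
    | succ k ihk =>
      simp only [mem_writes_parFor, not_exists, not_and] at h ihk
      rw [exec_parFor_succ, ih k (h k (by omega)), ihk fun i hi => h i (by omega)]

/-- The effect of a program on a set of locations that contains all those it reads depends only on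
the initial contents of that set. -/
theorem Prog.exec_congr {p : Prog} {A : Set ℕ} (hA : ∀ x ∈ p.reads, x ∈ A)
    {mem mem' : ℕ → ℂ} (h : Set.EqOn mem mem' A) : Set.EqOn (p.exec mem) (p.exec mem') A := by
  induction p generalizing mem mem' with
  | comb dst ts =>
    intro x hx
    have : ts.map (fun t => t.value mem) = ts.map fun t => t.value mem' := by
      refine List.map_congr_left fun t ht => ?_
      rw [Term.value, Term.value, h (hA _ (List.mem_map_of_mem ht))]
    simp only [exec, this, Function.update_apply, h hx]
  | seq p q hp hq =>
    simp only [mem_reads_seq] at hA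
    exact hq (fun x hx => hA x (.inr hx)) (hp (fun x hx => hA x (.inl hx)) h)
  | parFor k body ih =>
    simp only [mem_reads_parFor] at hA
    induction k with
    | zero => exact h
    | succ k ihk =>
      simp only [exec_parFor_succ]
      refine ih k (fun x hx => hA x ⟨k, by omega, hx⟩) (ihk ?_)
      rintro x ⟨i, hi, hx⟩
      exact hA x ⟨i, by omega, hx⟩

/-- In a race-free parallel loop, an iterate has the same effect as if it were run alone. -/
theorem Prog.exec_parFor_apply {k : ℕ} {body : ℕ → Prog} (hrf : (Prog.parFor k body).RaceFree)
    {i : ℕ} (hi : i < k) {x : ℕ} (hx : ∀ j < k, j ≠ i → x ∉ (body j).writes) (mem : ℕ → ℂ) :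
    (Prog.parFor k body).exec mem x = (body i).exec mem x := by
  rw [raceFree_parFor] at hrf
  -- Race-freedom puts all reads of iterate `i` into `A`. On `A` the memory keeps its initial
  -- contents until iterate `i` runs and keeps the result of that iterate afterwards.
  let A : Set ℕ := {y | ∀ j < k, j ≠ i → y ∉ (body j).writes}
  have hA : ∀ y ∈ (body i).reads, y ∈ A := fun y hy j hj hji hyw =>
    (hrf.2 j hj i hi hji y hyw).1 hy
  have key : ∀ n ≤ k, Set.EqOn ((Prog.parFor n body).exec mem)
      (if i < n then (body i).exec mem else mem) A := by
    intro n hn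
    induction n with
    | zero => intro y _; rfl
    | succ n ihn =>
      specialize ihn (by omega)
      rw [exec_parFor_succ]
      rcases lt_trichotomy i n with h | h | h
      · rw [if_pos h] at ihn
        rw [if_pos (by omega)]
        intro y hy
        rw [exec_of_notMem_writes (hy n (by omega) (by omega)), ihn hy]
      · subst h
        rw [if_neg (by omega)] at ihn
        rw [if_pos (by omega)]
        exact exec_congr hA ihn
      · rw [if_neg (by omega)] at ihn
        rw [if_neg (by omega)]
        intro y hy
        rw [exec_of_notMem_writes (hy n (by omega) (by omega)), ihn hy]
  have := key k le_rfl hx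
  rwa [if_pos hi] at this

/-! ### The building blocks: locations, races, effect -/

/-- The twiddle factor `exp (-2πi · a / N)`. -/
noncomputable def root (a N : ℕ) : ℂ := Complex.exp (-2 * Real.pi * Complex.I * (a : ℂ) / (N : ℂ))

theorem mul_add_inj {j j' i i' k : ℕ} (hi : i < k) (hi' : i' < k) (h : j * k + i = j' * k + i') :
    j = j' ∧ i = i' := by
  have h1 : (j * k + i) / k = j := by
    rw [mul_comm, Nat.mul_add_div (by omega), Nat.div_eq_of_lt hi, add_zero]
  have h2 : (j' * k + i') / k = j' := by
    rw [mul_comm, Nat.mul_add_div (by omega), Nat.div_eq_of_lt hi', add_zero]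
  have : j = j' := by rw [← h1, ← h2, h]
  subst this
  exact ⟨rfl, by omega⟩

theorem mul_add_lt {i j k m : ℕ} (hi : i < k) (hj : j < m) : i * m + j < k * m := by
  calc i * m + j < i * m + m := by omega
    _ = (i + 1) * m := by ring
    _ ≤ k * m := Nat.mul_le_mul_right m hi

theorem reads_par (p q : Prog) : (par p q).reads = p.reads ++ q.reads := by
  simp [par, Prog.reads, List.range_succ]

theorem writes_par (p q : Prog) : (par p q).writes = p.writes ++ q.writes := by
  simp [par, Prog.writes, List.range_succ]

theorem trace_par (p q : Prog) : (par p q).trace = p.trace ++ q.trace := by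
  simp [par, Prog.trace, List.range_succ]

theorem exec_par (p q : Prog) (mem : ℕ → ℂ) : (par p q).exec mem = q.exec (p.exec mem) := by
  simp [par, Prog.exec, List.range_succ]

theorem depth_par (ω : ℕ) (p q : Prog) : (par p q).depth ω = max (p.depth ω) (q.depth ω) := by
  simp [par, Prog.depth, Finset.range_add_one, max_comm]

theorem raceFree_par {p q : Prog} (hp : p.RaceFree) (hq : q.RaceFree)
    (h1 : ∀ x ∈ p.writes, x ∉ q.reads ∧ x ∉ q.writes) (h2 : ∀ x ∈ q.writes, x ∉ p.reads) :
    (par p q).RaceFree := by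
  rw [par, Prog.raceFree_parFor]
  refine ⟨fun i hi => by split_ifs <;> assumption, fun i hi j hj hij x hx => ?_⟩
  obtain ⟨rfl, rfl⟩ | ⟨rfl, rfl⟩ : i = 0 ∧ j = 1 ∨ i = 1 ∧ j = 0 := by omega
  · exact h1 x hx
  · exact ⟨h2 x hx, fun hx' => (h1 x hx').2 hx⟩

/-! #### Copying -/

theorem reads_copy (k s d : ℕ) : (copy k s d).reads = (List.range k).map (s + ·) := by
  simp only [copy, Prog.reads, List.map_cons, List.map_nil]
  exact (List.map_eq_flatMap ..).symm

theorem writes_copy (k s d : ℕ) : (copy k s d).writes = (List.range k).map (d + ·) := by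
  simp only [copy, Prog.writes]
  exact (List.map_eq_flatMap ..).symm

theorem raceFree_copy {k s d : ℕ} (h : s + k ≤ d ∨ d + k ≤ s) : (copy k s d).RaceFree := by
  rw [copy, Prog.raceFree_parFor]
  refine ⟨fun i hi => trivial, fun i hi j hj hij x hx => ?_⟩
  simp only [Prog.reads, Prog.writes, List.mem_singleton, List.map_cons, List.map_nil] at *
  omega

theorem exec_copy {k s d : ℕ} (h : s + k ≤ d ∨ d + k ≤ s) (mem : ℕ → ℂ) {i : ℕ} (hi : i < k) :
    (copy k s d).exec mem (d + i) = mem (s + i) := by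
  have hrf := raceFree_copy h
  rw [copy] at hrf ⊢
  rw [Prog.exec_parFor_apply hrf hi]
  · simp [Prog.exec, Term.value]
  · intro j hj hji hx
    simp only [Prog.writes, List.mem_singleton] at hx
    omega

/-! #### Transposition -/

theorem exists_of_mem_reads_transpose {p q s ss d ds x : ℕ}
    (hx : x ∈ (transpose p q s ss d ds).reads) : ∃ i < p, ∃ j < q, x = s + i * ss + j := by
  induction p, q, s, d using transpose.induct ss ds with
  | case1 p q s d h =>
    rw [transpose, if_pos h] at hx
    simp [reads_copy] at hx
  | case2 p q s d h h' =>
    rw [transpose, if_neg h, if_pos h'] at hx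
    simp only [reads_copy, List.range_one, List.map_cons, List.map_nil, List.mem_singleton] at hx
    exact ⟨0, by omega, 0, by omega, by omega⟩
  | case3 p q s d h h' hqp ih1 ih2 =>
    rw [transpose, if_neg h, if_neg h', if_pos hqp, reads_par, List.mem_append] at hx
    rcases hx with hx | hx
    · obtain ⟨i, hi, j, hj, rfl⟩ := ih1 hx
      exact ⟨i, by omega, j, hj, rfl⟩
    · obtain ⟨i, hi, j, hj, rfl⟩ := ih2 hx
      exact ⟨p / 2 + i, by omega, j, hj, by ring⟩
  | case4 p q s d h h' hqp ih1 ih2 =>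
    rw [transpose, if_neg h, if_neg h', if_neg hqp, reads_par, List.mem_append] at hx
    rcases hx with hx | hx
    · obtain ⟨i, hi, j, hj, rfl⟩ := ih1 hx
      exact ⟨i, hi, j, by omega, rfl⟩
    · obtain ⟨i, hi, j, hj, rfl⟩ := ih2 hx
      exact ⟨i, hi, q / 2 + j, by omega, by ring⟩

theorem exists_of_mem_writes_transpose {p q s ss d ds x : ℕ}
    (hx : x ∈ (transpose p q s ss d ds).writes) : ∃ i < p, ∃ j < q, x = d + j * ds + i := by
  induction p, q, s, d using transpose.induct ss ds with
  | case1 p q s d h =>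
    rw [transpose, if_pos h] at hx
    simp [writes_copy] at hx
  | case2 p q s d h h' =>
    rw [transpose, if_neg h, if_pos h'] at hx
    simp only [writes_copy, List.range_one, List.map_cons, List.map_nil, List.mem_singleton] at hx
    exact ⟨0, by omega, 0, by omega, by omega⟩
  | case3 p q s d h h' hqp ih1 ih2 =>
    rw [transpose, if_neg h, if_neg h', if_pos hqp, writes_par, List.mem_append] at hx
    rcases hx with hx | hx
    · obtain ⟨i, hi, j, hj, rfl⟩ := ih1 hx
      exact ⟨i, by omega, j, hj, rfl⟩
    · obtain ⟨i, hi, j, hj, rfl⟩ := ih2 hx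
      exact ⟨p / 2 + i, by omega, j, hj, by ring⟩
  | case4 p q s d h h' hqp ih1 ih2 =>
    rw [transpose, if_neg h, if_neg h', if_neg hqp, writes_par, List.mem_append] at hx
    rcases hx with hx | hx
    · obtain ⟨i, hi, j, hj, rfl⟩ := ih1 hx
      exact ⟨i, hi, j, by omega, rfl⟩
    · obtain ⟨i, hi, j, hj, rfl⟩ := ih2 hx
      exact ⟨i, hi, q / 2 + j, by omega, by ring⟩

/-- The source and the destination of a transposition are disjoint. -/
def TransposeDisjoint (p q s ss d ds : ℕ) : Prop :=
  ∀ i < p, ∀ j < q, ∀ i' < p, ∀ j' < q, s + i * ss + j ≠ d + j' * ds + i'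

theorem TransposeDisjoint.top {p q s ss d ds : ℕ} (h : TransposeDisjoint p q s ss d ds) :
    TransposeDisjoint (p / 2) q s ss d ds :=
  fun i hi j hj i' hi' j' hj' => h i (by omega) j hj i' (by omega) j' hj'

theorem TransposeDisjoint.bot {p q s ss d ds : ℕ} (h : TransposeDisjoint p q s ss d ds) :
    TransposeDisjoint (p - p / 2) q (s + p / 2 * ss) ss (d + p / 2) ds := by
  intro i hi j hj i' hi' j' hj'
  have := h (p / 2 + i) (by omega) j hj (p / 2 + i') (by omega) j' hj'
  rw [add_mul] at this
  omega

theorem TransposeDisjoint.left {p q s ss d ds : ℕ} (h : TransposeDisjoint p q s ss d ds) :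
    TransposeDisjoint p (q / 2) s ss d ds :=
  fun i hi j hj i' hi' j' hj' => h i hi j (by omega) i' hi' j' (by omega)

theorem TransposeDisjoint.right {p q s ss d ds : ℕ} (h : TransposeDisjoint p q s ss d ds) :
    TransposeDisjoint p (q - q / 2) (s + q / 2) ss (d + q / 2 * ds) ds := by
  intro i hi j hj i' hi' j' hj'
  have := h i hi (q / 2 + j) (by omega) i' hi' (q / 2 + j') (by omega)
  rw [add_mul] at this
  omega

/-- The bound `p ≤ ds` makes the coordinates of a written location unique, so the two halves write
to different places. Conflicts between a read and a write are excluded by the disjointness of source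
and destination. The stride `ss` is unconstrained because reads may coincide. -/
theorem raceFree_transpose {p q s ss d ds : ℕ} (hds : p ≤ ds)
    (hd : TransposeDisjoint p q s ss d ds) : (transpose p q s ss d ds).RaceFree := by
  induction p, q, s, d using transpose.induct ss ds with
  | case1 p q s d h =>
    rw [transpose, if_pos h, copy, Prog.raceFree_parFor]
    exact ⟨fun i hi => trivial, by omega⟩
  | case2 p q s d h h' =>
    rw [transpose, if_neg h, if_pos h', copy, Prog.raceFree_parFor]
    exact ⟨fun i hi => trivial, by omega⟩
  | case3 p q s d h h' hqp ih1 ih2 =>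
    rw [transpose, if_neg h, if_neg h', if_pos hqp]
    refine raceFree_par (ih1 (by omega) hd.top) (ih2 (by omega) hd.bot)
      (fun x hx => ⟨fun hx' => ?_, fun hx' => ?_⟩) fun x hx hx' => ?_
    · obtain ⟨i, hi, j, hj, rfl⟩ := exists_of_mem_writes_transpose hx
      obtain ⟨i', hi', j', hj', h2⟩ := exists_of_mem_reads_transpose hx'
      refine hd (p / 2 + i') (by omega) j' hj' i (by omega) j hj ?_
      rw [h2]; ring
    · obtain ⟨i, hi, j, hj, rfl⟩ := exists_of_mem_writes_transpose hx
      obtain ⟨i', hi', j', hj', h2⟩ := exists_of_mem_writes_transpose hx'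
      have := mul_add_inj (j := j) (j' := j') (i := i) (i' := p / 2 + i') (k := ds) (by omega)
        (by omega) (by omega)
      omega
    · obtain ⟨i, hi, j, hj, rfl⟩ := exists_of_mem_writes_transpose hx
      obtain ⟨i', hi', j', hj', h2⟩ := exists_of_mem_reads_transpose hx'
      exact hd i' (by omega) j' hj' (p / 2 + i) (by omega) j hj (by omega)
  | case4 p q s d h h' hqp ih1 ih2 =>
    rw [transpose, if_neg h, if_neg h', if_neg hqp]
    refine raceFree_par (ih1 (by omega) hd.left) (ih2 (by omega) hd.right)
      (fun x hx => ⟨fun hx' => ?_, fun hx' => ?_⟩) fun x hx hx' => ?_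
    · obtain ⟨i, hi, j, hj, rfl⟩ := exists_of_mem_writes_transpose hx
      obtain ⟨i', hi', j', hj', h2⟩ := exists_of_mem_reads_transpose hx'
      exact hd i' hi' (q / 2 + j') (by omega) i hi j (by omega) (by omega)
    · obtain ⟨i, hi, j, hj, rfl⟩ := exists_of_mem_writes_transpose hx
      obtain ⟨i', hi', j', hj', h2⟩ := exists_of_mem_writes_transpose hx'
      have := mul_add_inj (j := j) (j' := q / 2 + j') (i := i) (i' := i') (k := ds) (by omega)
        (by omega) (by rw [add_mul]; omega)
      omega
    · obtain ⟨i, hi, j, hj, rfl⟩ := exists_of_mem_writes_transpose hx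
      obtain ⟨i', hi', j', hj', h2⟩ := exists_of_mem_reads_transpose hx'
      refine hd i' hi' j' (by omega) i hi (q / 2 + j) (by omega) ?_
      rw [← h2]; ring

theorem exec_transpose {p q s ss d ds : ℕ} (hds : p ≤ ds)
    (hd : TransposeDisjoint p q s ss d ds) (mem : ℕ → ℂ) {i j : ℕ} (hi : i < p) (hj : j < q) :
    (transpose p q s ss d ds).exec mem (d + j * ds + i) = mem (s + i * ss + j) := by
  induction p, q, s, d using transpose.induct ss ds generalizing mem i j with
  | case1 p q s d h => omega
  | case2 p q s d h h' =>
    rw [transpose, if_neg h, if_pos h']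
    obtain ⟨rfl, rfl⟩ : i = 0 ∧ j = 0 := by omega
    simp [copy, Prog.exec, Term.value]
  | case3 p q s d h h' hqp ih1 ih2 =>
    rw [transpose, if_neg h, if_neg h', if_pos hqp, exec_par]
    rcases Nat.lt_or_ge i (p / 2) with hi2 | hi2
    · rw [Prog.exec_of_notMem_writes, ih1 (by omega) hd.top _ hi2 hj]
      intro hx
      obtain ⟨i', hi', j', hj', h2⟩ := exists_of_mem_writes_transpose hx
      have := mul_add_inj (j := j) (j' := j') (i := i) (i' := p / 2 + i') (k := ds) (by omega)
        (by omega) (by omega)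
      omega
    · obtain ⟨i, rfl⟩ := Nat.exists_eq_add_of_le hi2
      have := ih2 (by omega) hd.bot ((transpose (p / 2) q s ss d ds).exec mem) (i := i)
        (by omega) hj
      rw [show d + j * ds + (p / 2 + i) = d + p / 2 + j * ds + i by omega, this,
        Prog.exec_of_notMem_writes, add_mul, add_assoc s]
      intro hx
      obtain ⟨i', hi', j', hj', h2⟩ := exists_of_mem_writes_transpose hx
      refine hd (p / 2 + i) (by omega) j hj i' (by omega) j' hj' ?_
      rw [← h2]; ring
  | case4 p q s d h h' hqp ih1 ih2 =>
    rw [transpose, if_neg h, if_neg h', if_neg hqp, exec_par]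
    rcases Nat.lt_or_ge j (q / 2) with hj2 | hj2
    · rw [Prog.exec_of_notMem_writes, ih1 (by omega) hd.left _ hi hj2]
      intro hx
      obtain ⟨i', hi', j', hj', h2⟩ := exists_of_mem_writes_transpose hx
      have := mul_add_inj (j := j) (j' := q / 2 + j') (i := i) (i' := i') (k := ds) (by omega)
        (by omega) (by rw [add_mul]; omega)
      omega
    · obtain ⟨j, rfl⟩ := Nat.exists_eq_add_of_le hj2
      have := ih2 (by omega) hd.right ((transpose p (q / 2) s ss d ds).exec mem) (j := j)
        hi (by omega)
      rw [show d + (q / 2 + j) * ds + i = d + q / 2 * ds + j * ds + i by ring, this,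
        Prog.exec_of_notMem_writes]
      · congr 1; ring
      intro hx
      obtain ⟨i', hi', j', hj', h2⟩ := exists_of_mem_writes_transpose hx
      refine hd i hi (q / 2 + j) (by omega) i' (by omega) j' (by omega) ?_
      rw [← h2]; ring

theorem transposeDisjoint_of_contiguous {p q s d : ℕ} (h : s + p * q ≤ d ∨ d + p * q ≤ s) :
    TransposeDisjoint p q s q d p := by
  intro i hi j hj i' hi' j' hj'
  have h1 := mul_add_lt hi hj
  have h2 := mul_add_lt hj' hi'
  rw [mul_comm q p] at h2
  omega

/-! #### Brute-force discrete Fourier transforms -/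

theorem mem_reads_bruteDFT {k m s d x : ℕ} :
    x ∈ (bruteDFT k m s d).reads → s ≤ x ∧ x < s + k * m := by
  simp only [bruteDFT, Prog.mem_reads_parFor]
  rintro ⟨i', hi', j, hj, hx⟩
  simp only [Prog.reads, List.map_map, List.mem_map, List.mem_range, Function.comp] at hx
  obtain ⟨i, hi, rfl⟩ := hx
  have := mul_add_lt hj hi
  rw [mul_comm m k] at this
  omega

theorem mem_writes_bruteDFT {k m s d x : ℕ} :
    x ∈ (bruteDFT k m s d).writes → d ≤ x ∧ x < d + k * m := by
  simp only [bruteDFT, Prog.mem_writes_parFor]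
  rintro ⟨i', hi', j, hj, hx⟩
  simp only [Prog.writes, List.mem_singleton] at hx
  have := mul_add_lt hi' hj
  omega

theorem raceFree_bruteDFT {k m s d : ℕ} (h : s + k * m ≤ d ∨ d + k * m ≤ s) :
    (bruteDFT k m s d).RaceFree := by
  have aux : ∀ i' < k, ∀ j < m, ∀ x ∈ (List.range k).map (fun i => s + j * k + i),
      ∀ i'' < k, ∀ j' < m, x ≠ d + i'' * m + j' := by
    intro i' hi' j hj x hx i'' hi'' j' hj'
    simp only [List.mem_map, List.mem_range] at hx
    obtain ⟨i, hi, rfl⟩ := hx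
    have h1 := mul_add_lt hj hi
    have h2 := mul_add_lt hi'' hj'
    rw [mul_comm m k] at h1
    omega
  rw [bruteDFT, Prog.raceFree_parFor]
  refine ⟨fun i' hi' => ?_, fun i' hi' i'' hi'' hne x hx => ?_⟩
  · rw [Prog.raceFree_parFor]
    refine ⟨fun j hj => trivial, fun j hj j' hj' hne x hx => ?_⟩
    simp only [Prog.reads, Prog.writes, List.mem_singleton, List.map_map] at hx ⊢
    subst hx
    exact ⟨fun hx => aux i' hi' j' hj' _ hx i' hi' j hj rfl, by omega⟩
  · simp only [Prog.mem_writes_parFor, Prog.mem_reads_parFor] at hx ⊢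
    obtain ⟨j, hj, hx⟩ := hx
    simp only [Prog.reads, Prog.writes, List.mem_singleton, List.map_map] at hx ⊢
    subst hx
    refine ⟨?_, ?_⟩
    · rintro ⟨j', hj', hx⟩
      exact aux i'' hi'' j' hj' _ hx i' hi' j hj rfl
    · rintro ⟨j', hj', hx⟩
      have := mul_add_inj (j := i') (j' := i'') hj hj' (by omega)
      omega

theorem exec_bruteDFT {k m s d : ℕ} (h : s + k * m ≤ d ∨ d + k * m ≤ s) (mem : ℕ → ℂ)
    {i' j : ℕ} (hi' : i' < k) (hj : j < m) :
    (bruteDFT k m s d).exec mem (d + i' * m + j) =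
      ∑ i ∈ Finset.range k, root (i * i') k * mem (s + j * k + i) := by
  have hrf := raceFree_bruteDFT h
  rw [bruteDFT] at hrf ⊢
  rw [Prog.exec_parFor_apply hrf hi',
    Prog.exec_parFor_apply ((Prog.raceFree_parFor.1 hrf).1 i' hi') hj]
  · simp only [Prog.exec, Function.update_self, List.map_map]
    rfl
  · intro j' hj' hne hx
    simp only [Prog.writes, List.mem_singleton] at hx
    omega
  · intro i'' hi'' hne hx
    rw [Prog.mem_writes_parFor] at hx
    obtain ⟨j', hj', hx⟩ := hx
    simp only [Prog.writes, List.mem_singleton] at hx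
    have := mul_add_inj (j := i') (j' := i'') hj hj' (by omega)
    omega

/-! #### Twiddle factors -/

theorem mem_reads_twiddle {k m N : ℕ} {e : ℕ → ℕ → ℕ} {s x : ℕ} :
    x ∈ (twiddle k m N e s).reads → s ≤ x ∧ x < s + k * m := by
  simp only [twiddle, Prog.mem_reads_parFor]
  rintro ⟨i, hi, j, hj, hx⟩
  simp only [Prog.reads, List.mem_singleton, List.map_cons, List.map_nil] at hx
  have := mul_add_lt hi hj
  omega

theorem mem_writes_twiddle {k m N : ℕ} {e : ℕ → ℕ → ℕ} {s x : ℕ} :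
    x ∈ (twiddle k m N e s).writes → s ≤ x ∧ x < s + k * m := by
  simp only [twiddle, Prog.mem_writes_parFor]
  rintro ⟨i, hi, j, hj, hx⟩
  simp only [Prog.writes, List.mem_singleton] at hx
  have := mul_add_lt hi hj
  omega

theorem raceFree_twiddle (k m N : ℕ) (e : ℕ → ℕ → ℕ) (s : ℕ) : (twiddle k m N e s).RaceFree := by
  rw [twiddle, Prog.raceFree_parFor]
  refine ⟨fun i hi => ?_, fun i hi i' hi' hne x hx => ?_⟩
  · rw [Prog.raceFree_parFor]
    refine ⟨fun j hj => trivial, fun j hj j' hj' hne x hx => ?_⟩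
    simp only [Prog.reads, Prog.writes, List.mem_singleton, List.map_cons, List.map_nil] at hx ⊢
    omega
  · simp only [Prog.mem_writes_parFor, Prog.mem_reads_parFor] at hx ⊢
    obtain ⟨j, hj, hx⟩ := hx
    simp only [Prog.reads, Prog.writes, List.mem_singleton, List.map_cons, List.map_nil] at hx ⊢
    subst hx
    rw [and_self_iff]
    rintro ⟨j', hj', hx⟩
    have := mul_add_inj (j := i) (j' := i') hj hj' (by omega)
    omega

theorem exec_twiddle {k m N : ℕ} {e : ℕ → ℕ → ℕ} {s : ℕ} (mem : ℕ → ℂ) {i j : ℕ}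
    (hi : i < k) (hj : j < m) :
    (twiddle k m N e s).exec mem (s + i * m + j) = root (e i j) N * mem (s + i * m + j) := by
  have hrf := raceFree_twiddle k m N e s
  rw [twiddle] at hrf ⊢
  rw [Prog.exec_parFor_apply hrf hi,
    Prog.exec_parFor_apply ((Prog.raceFree_parFor.1 hrf).1 i hi) hj]
  · simp [Prog.exec, Term.value, root]
  · intro j' hj' hne hx
    simp only [Prog.writes, List.mem_singleton] at hx
    omega
  · intro i'' hi'' hne hx
    rw [Prog.mem_writes_parFor] at hx
    obtain ⟨j', hj', hx⟩ := hx
    simp only [Prog.writes, List.mem_singleton] at hx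
    have := mul_add_inj (j := i) (j' := i'') hj hj' (by omega)
    omega

/-! ### The Cooley–Tukey factorisation -/

theorem root_add (a b N : ℕ) : root (a + b) N = root a N * root b N := by
  rw [root, root, root, ← Complex.exp_add]
  congr 1
  push_cast
  ring

theorem root_mul_right (a N : ℕ) {c : ℕ} (hc : c ≠ 0) : root (a * c) (N * c) = root a N := by
  rw [root, root]
  push_cast
  rw [← mul_assoc, mul_div_mul_right _ _ (by exact_mod_cast hc)]

theorem root_mul_self (a : ℕ) {N : ℕ} (hN : N ≠ 0) : root (a * N) N = 1 := by
  have hN' : (N : ℂ) ≠ 0 := by exact_mod_cast hN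
  rw [root, Complex.exp_eq_one_iff]
  refine ⟨-a, ?_⟩
  push_cast
  field_simp

theorem sum_range_mul (p q : ℕ) (f : ℕ → ℂ) :
    ∑ u ∈ Finset.range (p * q), f u =
      ∑ i ∈ Finset.range p, ∑ j ∈ Finset.range q, f (i * q + j) := by
  induction p with
  | zero => simp
  | succ p ih => rw [add_mul, one_mul, Finset.sum_range_add, ih, Finset.sum_range_succ]

/-- The product of the indices is `i i' q + i j' (p q) + i' j + j j' p`. Modulo `p q` the second
term vanishes, and the first and the last are exponents for the orders `p` and `q`. -/
theorem root_factor {p q : ℕ} (hp : p ≠ 0) (hq : q ≠ 0) (i j i' j' : ℕ) :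
    root ((i * q + j) * (i' + p * j')) (p * q) =
      root (j * j') q * (root (i' * j) (p * q) * root (i * i') p) := by
  have h1 : (i * q + j) * (i' + p * j') =
      i * i' * q + i * j' * (p * q) + i' * j + j * j' * p := by ring
  rw [h1, root_add, root_add, root_add, root_mul_right _ _ hq,
    root_mul_self _ (mul_ne_zero hp hq), mul_comm p q, root_mul_right _ _ hp]
  ring

theorem cooleyTukey {p q : ℕ} (hp : p ≠ 0) (hq : q ≠ 0) (f : ℕ → ℂ) (i' j' : ℕ) :
    ∑ u ∈ Finset.range (p * q), root (u * (i' + p * j')) (p * q) * f u =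
      ∑ j ∈ Finset.range q, root (j * j') q *
        (root (i' * j) (p * q) * ∑ i ∈ Finset.range p, root (i * i') p * f (i * q + j)) := by
  rw [sum_range_mul, Finset.sum_comm]
  refine Finset.sum_congr rfl fun j _ => ?_
  rw [Finset.mul_sum, Finset.mul_sum]
  refine Finset.sum_congr rfl fun i _ => ?_
  rw [root_factor hp hq]
  ring

/-! ### The recursion -/

theorem FFTSize.pos {ω n : ℕ} (hω : 0 < ω) (h : FFTSize ω n) : 0 < n := by
  induction h with
  | base e h => positivity
  | step m h ih => positivity

/-- Induction along the recursion of the algorithm. -/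
theorem FFTSize.recOn' {ω : ℕ} (hω : 0 < ω) {motive : ℕ → Prop}
    (small : ∀ n, 0 < n → n ≤ ω → motive n)
    (step : ∀ m, 2 ≤ m → FFTSize ω m → motive m → motive (ω * m ^ 2)) {n : ℕ}
    (h : FFTSize ω n) : motive n := by
  induction h with
  | base e h => exact small _ (by positivity) h
  | step m h ih =>
    have := h.pos hω
    -- For `m = 1` the constructor `step` gives the size `ω`, which the algorithm treats by brute
    -- force.
    rcases Nat.lt_or_ge m 2 with hm | hm
    · obtain rfl : m = 1 := by omega
      exact small _ (by positivity) (by simp)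
    · exact step m hm h ih

/-- `k` transforms of `m` words each, on contiguous data. -/
def fftLoop (ω k m a t : ℕ) : Prog := .parFor k fun i => fft ω m (a + i * m) (t + i * m)

/-- The transform of one row in the second step of the algorithm: the row is the `ω m` words from
`t`, the result goes to the `ω m` words from `a`. -/
def fftRow (ω m n r a t : ℕ) : Prog :=
  .seq (transpose ω m t m a ω) <|
  .seq (bruteDFT ω m a t) <|
  .seq (twiddle ω m (ω * m) (fun i j => i * j) t) <|
  .seq (fftLoop ω ω m t a) <|
  .seq (twiddle ω m n (fun i j => r * (i + ω * j)) t) <|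
  transpose ω m t m a ω

theorem fft_of_le {ω n : ℕ} (h : n ≤ ω) (a t : ℕ) :
    fft ω n a t = .seq (bruteDFT n 1 a t) (copy n t a) := by
  rw [fft, dif_pos h]

/-- On sizes `ω m²` the integer square root is exact, and `2 ≤ m` is what selects the recursive
branch. -/
theorem fft_step {ω m : ℕ} (hω : 0 < ω) (hm : 2 ≤ m) (a t : ℕ) :
    fft ω (ω * m ^ 2) a t =
      .seq (transpose (ω * m) m a m t (ω * m)) (
      .seq (.parFor m fun r =>
        fftRow ω m (ω * m ^ 2) r (a + r * (ω * m)) (t + r * (ω * m))) (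
      .seq (transpose m (ω * m) a (ω * m) t m) (
      .seq (fftLoop ω (ω * m) m t a) (
      transpose (ω * m) m t m a (ω * m))))) := by
  have h1 : ¬ ω * m ^ 2 ≤ ω := by
    have : ω * 1 < ω * m ^ 2 := Nat.mul_lt_mul_of_pos_left (by nlinarith) hω
    omega
  have h2 : Nat.sqrt (ω * m ^ 2 / ω) = m := by
    rw [Nat.mul_div_cancel_left _ hω, Nat.sqrt_eq']
  rw [fft, dif_neg h1]
  simp only [h2]
  rfl

/-! ### Footprints -/

/-- The program touches only the `n` words from `a` and the `n` words from `t`. -/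
def Prog.Within (p : Prog) (a t n : ℕ) : Prop :=
  ∀ x, x ∈ p.reads ∨ x ∈ p.writes → (a ≤ x ∧ x < a + n) ∨ (t ≤ x ∧ x < t + n)

theorem Prog.Within.symm {p : Prog} {a t n : ℕ} (h : p.Within a t n) : p.Within t a n :=
  fun x hx => (h x hx).symm

theorem Prog.Within.seq {p q : Prog} {a t n : ℕ} (hp : p.Within a t n) (hq : q.Within a t n) :
    (Prog.seq p q).Within a t n := by
  intro x hx
  rw [mem_reads_seq, mem_writes_seq] at hx
  rcases hx with (hx | hx) | (hx | hx)
  · exact hp x (.inl hx)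
  · exact hq x (.inl hx)
  · exact hp x (.inr hx)
  · exact hq x (.inr hx)

theorem Prog.within_parFor {k m a t : ℕ} {body : ℕ → Prog}
    (h : ∀ i < k, (body i).Within (a + i * m) (t + i * m) m) :
    (Prog.parFor k body).Within a t (k * m) := by
  intro x hx
  rw [mem_reads_parFor, mem_writes_parFor] at hx
  have : ∃ i < k, x ∈ (body i).reads ∨ x ∈ (body i).writes := by grind
  obtain ⟨i, hi, hx⟩ := this
  have h1 := h i hi x hx
  have h2 : (i + 1) * m ≤ k * m := Nat.mul_le_mul_right m hi
  rw [add_mul] at h2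
  omega

/-- Iterate `i` lives in the `i`-th chunk of length `m` of both arrays, so distinct iterates share
no location at all, not even for reading. -/
theorem disjoint_of_within {k m a t : ℕ} {body : ℕ → Prog}
    (h : ∀ i < k, (body i).Within (a + i * m) (t + i * m) m)
    (hd : a + k * m ≤ t ∨ t + k * m ≤ a) {i j : ℕ} (hi : i < k) (hj : j < k) (hij : i ≠ j) {x : ℕ}
    (hx : x ∈ (body i).reads ∨ x ∈ (body i).writes) :
    ¬ (x ∈ (body j).reads ∨ x ∈ (body j).writes) := by
  intro hx'
  have h1 := h i hi x hx
  have h2 := h j hj x hx'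
  have h3 : (i + 1) * m ≤ k * m := Nat.mul_le_mul_right m hi
  have h4 : (j + 1) * m ≤ k * m := Nat.mul_le_mul_right m hj
  have h5 : (i + 1) * m ≤ j * m ∨ (j + 1) * m ≤ i * m := by
    rcases Nat.lt_or_gt_of_ne hij with h | h
    · exact .inl (Nat.mul_le_mul_right m h)
    · exact .inr (Nat.mul_le_mul_right m h)
  simp only [add_mul, one_mul] at h3 h4 h5
  omega

theorem Prog.raceFree_parFor_of_within {k m a t : ℕ} {body : ℕ → Prog}
    (h : ∀ i < k, (body i).Within (a + i * m) (t + i * m) m)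
    (hd : a + k * m ≤ t ∨ t + k * m ≤ a) (hrf : ∀ i < k, (body i).RaceFree) :
    (Prog.parFor k body).RaceFree := by
  rw [raceFree_parFor]
  refine ⟨hrf, fun i hi j hj hij x hx => ?_⟩
  have := disjoint_of_within h hd hi hj hij (.inr hx)
  exact not_or.1 this

theorem exec_parFor_of_within {k m a t : ℕ} {body : ℕ → Prog}
    (h : ∀ i < k, (body i).Within (a + i * m) (t + i * m) m)
    (hd : a + k * m ≤ t ∨ t + k * m ≤ a) (hrf : ∀ i < k, (body i).RaceFree) (mem : ℕ → ℂ)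
    {i x : ℕ} (hi : i < k) (hx : a + i * m ≤ x ∧ x < a + i * m + m) :
    (Prog.parFor k body).exec mem x = (body i).exec mem x := by
  refine Prog.exec_parFor_apply (Prog.raceFree_parFor_of_within h hd hrf) hi
    (fun j hj hji hx' => ?_) mem
  have h2 := h j hj x (.inr hx')
  have h3 : (i + 1) * m ≤ k * m := Nat.mul_le_mul_right m hi
  have h4 : (j + 1) * m ≤ k * m := Nat.mul_le_mul_right m hj
  have h5 : (i + 1) * m ≤ j * m ∨ (j + 1) * m ≤ i * m := by
    rcases Nat.lt_or_gt_of_ne hji with h | h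
    · exact .inr (Nat.mul_le_mul_right m h)
    · exact .inl (Nat.mul_le_mul_right m h)
  simp only [add_mul, one_mul] at h3 h4 h5
  omega

theorem within_transpose (p q s d : ℕ) : (transpose p q s q d p).Within s d (p * q) := by
  rintro x (hx | hx)
  · obtain ⟨i, hi, j, hj, rfl⟩ := exists_of_mem_reads_transpose hx
    have := mul_add_lt hi hj
    omega
  · obtain ⟨i, hi, j, hj, rfl⟩ := exists_of_mem_writes_transpose hx
    have := mul_add_lt hj hi
    rw [mul_comm q p] at this
    omega

theorem within_bruteDFT (k m s d : ℕ) : (bruteDFT k m s d).Within s d (k * m) := by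
  rintro x (hx | hx)
  · exact .inl (mem_reads_bruteDFT hx)
  · exact .inr (mem_writes_bruteDFT hx)

theorem within_twiddle (k m N : ℕ) (e : ℕ → ℕ → ℕ) (s d : ℕ) :
    (twiddle k m N e s).Within s d (k * m) := by
  rintro x (hx | hx)
  · exact .inl (mem_reads_twiddle hx)
  · exact .inl (mem_writes_twiddle hx)

theorem within_copy (k s d : ℕ) : (copy k s d).Within s d k := by
  intro x hx
  simp only [reads_copy, writes_copy, List.mem_map, List.mem_range] at hx
  rcases hx with ⟨i, hi, rfl⟩ | ⟨i, hi, rfl⟩ <;> omega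

theorem within_fftRow {ω m : ℕ} (h : ∀ a t, (fft ω m a t).Within a t m) (n r a t : ℕ) :
    (fftRow ω m n r a t).Within a t (ω * m) := by
  refine (within_transpose _ _ _ _).symm.seq <| (within_bruteDFT _ _ _ _).seq <|
    (within_twiddle _ _ _ _ _ _).symm.seq <| Prog.Within.seq ?_ <| (within_twiddle _ _ _ _ _ _).symm.seq <|
    (within_transpose _ _ _ _).symm
  exact (Prog.within_parFor fun i _ => h _ _).symm

theorem within_fft {ω n : ℕ} (hω : 0 < ω) (hn : FFTSize ω n) :
    ∀ a t, (fft ω n a t).Within a t n := by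
  refine hn.recOn' hω (motive := fun n => ∀ a t, (fft ω n a t).Within a t n) ?_ ?_
  · intro n _ hn a t
    rw [fft_of_le hn]
    refine Prog.Within.seq ?_ (within_copy _ _ _).symm
    simpa using within_bruteDFT n 1 a t
  · intro m hm _ ih a t
    have e1 : ω * m ^ 2 = ω * m * m := by ring
    have e2 : ω * m ^ 2 = m * (ω * m) := by ring
    rw [fft_step hω hm]
    refine Prog.Within.seq ?_ <| Prog.Within.seq ?_ <| Prog.Within.seq ?_ <| Prog.Within.seq ?_ ?_
    · rw [e1]; exact within_transpose _ _ _ _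
    · rw [e2]; exact Prog.within_parFor fun r _ => within_fftRow ih _ _ _ _
    · rw [e2]; exact within_transpose _ _ _ _
    · rw [e1]; exact (Prog.within_parFor fun i _ => ih _ _).symm
    · rw [e1]; exact (within_transpose _ _ _ _).symm

/-! ### The algorithm is race-free -/

theorem raceFree_fftLoop {ω m : ℕ} (hw : ∀ a t, (fft ω m a t).Within a t m)
    (h : ∀ a t, a + m ≤ t ∨ t + m ≤ a → (fft ω m a t).RaceFree) {k a t : ℕ}
    (hd : a + k * m ≤ t ∨ t + k * m ≤ a) : (fftLoop ω k m a t).RaceFree := by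
  refine Prog.raceFree_parFor_of_within (fun i _ => hw _ _) hd fun i hi => h _ _ ?_
  have h2 : (i + 1) * m ≤ k * m := Nat.mul_le_mul_right m hi
  rw [add_mul] at h2
  omega

theorem raceFree_fftRow {ω m : ℕ} (hw : ∀ a t, (fft ω m a t).Within a t m)
    (h : ∀ a t, a + m ≤ t ∨ t + m ≤ a → (fft ω m a t).RaceFree) (n r : ℕ) {a t : ℕ}
    (hd : a + ω * m ≤ t ∨ t + ω * m ≤ a) : (fftRow ω m n r a t).RaceFree :=
  have ht : (transpose ω m t m a ω).RaceFree :=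
    raceFree_transpose le_rfl (transposeDisjoint_of_contiguous hd.symm)
  ⟨ht, raceFree_bruteDFT hd, raceFree_twiddle .., raceFree_fftLoop hw h hd.symm,
    raceFree_twiddle .., ht⟩

theorem raceFree_fft {ω n : ℕ} (hω : 0 < ω) (hn : FFTSize ω n) :
    ∀ a t, a + n ≤ t ∨ t + n ≤ a → (fft ω n a t).RaceFree := by
  refine hn.recOn' hω
    (motive := fun n => ∀ a t, a + n ≤ t ∨ t + n ≤ a → (fft ω n a t).RaceFree) ?_ ?_
  · intro n _ hn a t hd
    rw [fft_of_le hn]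
    exact ⟨raceFree_bruteDFT (by simpa using hd), raceFree_copy hd.symm⟩
  · intro m hm hs ih a t hd
    have e1 : ω * m ^ 2 = ω * m * m := by ring
    have e2 : ω * m ^ 2 = m * (ω * m) := by ring
    have hw := within_fft hω hs
    have hd1 := hd
    have hd2 := hd
    rw [e1] at hd1
    rw [e2] at hd2
    rw [fft_step hω hm]
    refine ⟨raceFree_transpose le_rfl (transposeDisjoint_of_contiguous hd1), ?_,
      raceFree_transpose le_rfl (transposeDisjoint_of_contiguous hd2),
      raceFree_fftLoop hw ih hd1.symm,
      raceFree_transpose le_rfl (transposeDisjoint_of_contiguous hd1.symm)⟩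
    refine Prog.raceFree_parFor_of_within (fun r _ => within_fftRow hw _ _ _ _) hd2 fun r hr =>
      raceFree_fftRow hw ih _ _ ?_
    have h2 : (r + 1) * (ω * m) ≤ m * (ω * m) := Nat.mul_le_mul_right _ hr
    rw [add_mul] at h2
    omega

theorem Prog.exec_seq (p q : Prog) (mem : ℕ → ℂ) :
    (Prog.seq p q).exec mem = q.exec (p.exec mem) := rfl

/-! ### The algorithm computes the discrete Fourier transform -/

/-- `fft ω n a t` replaces the `n` words from `a` by their discrete Fourier transform. -/
def FFTSpec (ω n : ℕ) : Prop :=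
  ∀ a t, a + n ≤ t ∨ t + n ≤ a → ∀ mem : ℕ → ℂ, ∀ k < n,
    (fft ω n a t).exec mem (a + k) = ∑ j ∈ Finset.range n, root (j * k) n * mem (a + j)

theorem exec_fftLoop {ω m : ℕ} (hω : 0 < ω) (hs : FFTSize ω m) (h : FFTSpec ω m) {k a t : ℕ}
    (hd : a + k * m ≤ t ∨ t + k * m ≤ a) (mem : ℕ → ℂ) {i q : ℕ} (hi : i < k) (hq : q < m) :
    (fftLoop ω k m a t).exec mem (a + i * m + q) =
      ∑ j ∈ Finset.range m, root (j * q) m * mem (a + i * m + j) := by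
  have hd' : ∀ i < k, a + i * m + m ≤ t + i * m ∨ t + i * m + m ≤ a + i * m := by
    intro i hi
    have h2 : (i + 1) * m ≤ k * m := Nat.mul_le_mul_right m hi
    rw [add_mul] at h2
    omega
  rw [fftLoop, exec_parFor_of_within (fun i _ => within_fft hω hs _ _) hd
    (fun i hi => raceFree_fft hω hs _ _ (hd' i hi)) mem hi (by omega)]
  exact h _ _ (hd' i hi) mem q hq

/-- This is Cooley–Tukey with factors `ω` and `m` for the output index `p = i' + ω j'`. The final
transposition moves entry `(i', j')` to offset `i' + ω j'`, so the second twiddle exponent is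
exactly `r p`, the one that the outer factorisation requires. -/
theorem exec_fftRow {ω m : ℕ} (hω : 0 < ω) (hs : FFTSize ω m) (h : FFTSpec ω m) (n r : ℕ)
    {a t : ℕ} (hd : a + ω * m ≤ t ∨ t + ω * m ≤ a) (mem : ℕ → ℂ) {p : ℕ} (hp : p < ω * m) :
    (fftRow ω m n r a t).exec mem (a + p) = root (r * p) n *
      ∑ u ∈ Finset.range (ω * m), root (u * p) (ω * m) * mem (t + u) := by
  have hm : 0 < m := hs.pos hω
  obtain ⟨i', j', hi', hj', rfl⟩ : ∃ i' j', i' < ω ∧ j' < m ∧ p = i' + ω * j' :=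
    ⟨p % ω, p / ω, Nat.mod_lt _ hω, Nat.div_lt_of_lt_mul hp, (Nat.mod_add_div ..).symm⟩
  have htr := transposeDisjoint_of_contiguous hd.symm
  rw [fftRow]
  simp only [Prog.exec_seq]
  rw [show a + (i' + ω * j') = a + j' * ω + i' by ring,
    exec_transpose le_rfl htr _ hi' hj', exec_twiddle _ hi' hj',
    exec_fftLoop hω hs h hd.symm _ hi' hj', cooleyTukey hω.ne' hm.ne']
  congr 1
  refine Finset.sum_congr rfl fun j hj => ?_
  rw [Finset.mem_range] at hj
  rw [exec_twiddle _ hi' hj, exec_bruteDFT hd _ hi' hj]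
  congr 2
  refine Finset.sum_congr rfl fun i hi => ?_
  rw [Finset.mem_range] at hi
  rw [exec_transpose le_rfl htr _ hi hj, add_assoc]

/-- The outer step is Cooley–Tukey with factors `ω m` and `m`. The row transforms supply its inner
sums together with the twiddle factors, and the second recursive loop supplies the outer sums of
length `m`. -/
theorem fftSpec {ω n : ℕ} (hω : 0 < ω) (hn : FFTSize ω n) : FFTSpec ω n := by
  refine hn.recOn' hω (motive := FFTSpec ω) ?_ ?_
  · intro n _ hn a t hd mem k hk
    rw [fft_of_le hn, Prog.exec, exec_copy hd.symm _ hk]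
    have := exec_bruteDFT (k := n) (m := 1) (s := a) (d := t) (by simpa using hd) mem hk
      zero_lt_one
    simpa using this
  · intro m hm hs ih a t hd mem k hk
    have e1 : ω * m ^ 2 = ω * m * m := by ring
    have e2 : ω * m ^ 2 = m * (ω * m) := by ring
    have hl : 0 < ω * m := by positivity
    have hd1 := hd
    have hd2 := hd
    rw [e1] at hd1
    rw [e2] at hd2
    obtain ⟨p', q', hp', hq', rfl⟩ : ∃ p' q', p' < ω * m ∧ q' < m ∧ k = p' + ω * m * q' :=
      ⟨k % (ω * m), k / (ω * m), Nat.mod_lt _ hl, Nat.div_lt_of_lt_mul (e1 ▸ hk),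
        (Nat.mod_add_div ..).symm⟩
    have hdr : ∀ r < m, a + r * (ω * m) + ω * m ≤ t + r * (ω * m) ∨
        t + r * (ω * m) + ω * m ≤ a + r * (ω * m) := by
      intro r hr
      have h2 : (r + 1) * (ω * m) ≤ m * (ω * m) := Nat.mul_le_mul_right _ hr
      rw [add_mul] at h2
      omega
    rw [fft_step hω hm]
    simp only [Prog.exec_seq]
    rw [show a + (p' + ω * m * q') = a + q' * (ω * m) + p' by ring,
      exec_transpose le_rfl (transposeDisjoint_of_contiguous hd1.symm) _ hp' hq',
      exec_fftLoop hω hs ih hd1.symm _ hp' hq', e1, cooleyTukey hl.ne' (by omega)]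
    refine Finset.sum_congr rfl fun r hr => ?_
    rw [Finset.mem_range] at hr
    have hw := within_fft hω hs
    have := exec_parFor_of_within
      (body := fun r => fftRow ω m (ω * m * m) r (a + r * (ω * m)) (t + r * (ω * m)))
      (fun r _ => within_fftRow hw _ _ _ _) hd2
      (fun r hr => raceFree_fftRow hw (raceFree_fft hω hs) _ _ (hdr r hr))
      ((transpose (ω * m) m a m t (ω * m)).exec mem) hr (x := a + r * (ω * m) + p') (by omega)
    rw [exec_transpose le_rfl (transposeDisjoint_of_contiguous hd2) _ hr hp', this,
      exec_fftRow hω hs ih _ _ (hdr r hr) _ hp', mul_comm r p']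
    congr 2
    refine Finset.sum_congr rfl fun i hi => ?_
    rw [Finset.mem_range] at hi
    rw [exec_transpose le_rfl (transposeDisjoint_of_contiguous hd1) _ hi hr, add_assoc]

theorem exec_fft_eq_dft {ω n : ℕ} (hω : 0 < ω) (hn : FFTSize ω n) [NeZero n] (mem : ℕ → ℂ)
    (k : ZMod n) :
    (fft ω n 0 n).exec mem k.val = ZMod.dft (fun j : ZMod n => mem j.val) k := by
  have := fftSpec hω hn 0 n (by omega) mem k.val (ZMod.val_lt k)
  simp only [zero_add] at this
  rw [this, ZMod.dft_apply, Finset.sum_range]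
  -- For a successor, `ZMod (n + 1)` is `Fin (n + 1)` by definition, so the two sums have the same
  -- index type.
  obtain ⟨n, rfl⟩ := Nat.exists_eq_succ_of_ne_zero (NeZero.ne n)
  refine Finset.sum_congr rfl fun (j : ZMod (n + 1)) _ => ?_
  rw [smul_eq_mul]
  congr 1
  have h1 : (-(j * k) : ZMod (n + 1)) = ((-((ZMod.val j * ZMod.val k : ℕ) : ℤ) : ℤ) : ZMod (n + 1)) := by
    push_cast
    simp
  rw [h1, ZMod.stdAddChar_coe, root]
  congr 1
  push_cast
  change -2 * Real.pi * Complex.I * ((ZMod.val j : ℂ) * (ZMod.val k : ℂ)) / (n + 1) = _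
  ring

/-! ### Depth -/

theorem Prog.depth_parFor_le {ω k D : ℕ} {body : ℕ → Prog} (h : ∀ i < k, (body i).depth ω ≤ D) :
    (Prog.parFor k body).depth ω ≤ D :=
  Finset.sup_le fun i hi => h i (Finset.mem_range.1 hi)

theorem depth_copy_le (ω k s d : ℕ) : (copy k s d).depth ω ≤ 4 + ω :=
  Prog.depth_parFor_le fun i _ => by simp [Prog.depth]

/-- The depth of a parallel composition is a maximum, so only a single copied word counts. -/
theorem depth_transpose_le (ω p q s ss d ds : ℕ) : (transpose p q s ss d ds).depth ω ≤ 4 + ω := by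
  induction p, q, s, d using transpose.induct ss ds with
  | case1 p q s d h => rw [transpose, if_pos h]; exact depth_copy_le ..
  | case2 p q s d h h' => rw [transpose, if_neg h, if_pos h']; exact depth_copy_le ..
  | case3 p q s d h h' hqp ih1 ih2 =>
    rw [transpose, if_neg h, if_neg h', if_pos hqp, depth_par]
    exact max_le ih1 ih2
  | case4 p q s d h h' hqp ih1 ih2 =>
    rw [transpose, if_neg h, if_neg h', if_neg hqp, depth_par]
    exact max_le ih1 ih2

theorem depth_bruteDFT_le (ω k m s d : ℕ) : (bruteDFT k m s d).depth ω ≤ 4 * k + ω :=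
  Prog.depth_parFor_le fun i _ => Prog.depth_parFor_le fun j _ => by simp [Prog.depth]

theorem depth_twiddle_le (ω k m N : ℕ) (e : ℕ → ℕ → ℕ) (s : ℕ) :
    (twiddle k m N e s).depth ω ≤ 4 + ω :=
  Prog.depth_parFor_le fun i _ => Prog.depth_parFor_le fun j _ => by simp [Prog.depth]

theorem depth_fftRow_le {ω m D : ℕ} (h : ∀ a t, (fft ω m a t).depth ω ≤ D) (n r a t : ℕ) :
    (fftRow ω m n r a t).depth ω ≤ D + 9 * ω + 16 := by
  have h1 := depth_transpose_le ω ω m t m a ω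
  have h2 := depth_bruteDFT_le ω ω m a t
  have h3 := depth_twiddle_le ω ω m (ω * m) (fun i j => i * j) t
  have h4 := depth_twiddle_le ω ω m n (fun i j => r * (i + ω * j)) t
  have h5 : (fftLoop ω ω m t a).depth ω ≤ D := Prog.depth_parFor_le fun i _ => h _ _
  simp only [fftRow, Prog.depth]
  omega

/-- The three transpositions contribute `12 + 3 ω` and the row step `9 ω + 16` beyond the recursive
calls. The total `12 ω + 28` is at most `26 ω` because `ω ≥ 2`. -/
theorem depth_fft_step_le {ω m D : ℕ} (hω : 2 ≤ ω) (hm : 2 ≤ m)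
    (h : ∀ a t, (fft ω m a t).depth ω ≤ D) (a t : ℕ) :
    (fft ω (ω * m ^ 2) a t).depth ω ≤ 2 * D + 26 * ω := by
  have h1 := depth_transpose_le ω (ω * m) m a m t (ω * m)
  have h2 := depth_transpose_le ω m (ω * m) a (ω * m) t m
  have h3 := depth_transpose_le ω (ω * m) m t m a (ω * m)
  have h4 : (fftLoop ω (ω * m) m t a).depth ω ≤ D := Prog.depth_parFor_le fun i _ => h _ _
  have h5 : (Prog.parFor m fun r =>
      fftRow ω m (ω * m ^ 2) r (a + r * (ω * m)) (t + r * (ω * m))).depth ω ≤ D + 9 * ω + 16 :=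
    Prog.depth_parFor_le fun r _ => depth_fftRow_le h _ _ _ _
  rw [fft_step (by omega) hm]
  rw [Prog.depth, Prog.depth, Prog.depth, Prog.depth]
  omega

/-- The bound solves `D(ω m²) ≤ 2 D(m) + 26 ω`: the term `-26 ω` absorbs the additive cost, and the
doubled `34 ω` is paid by `log₂ ω ≥ 1`. At `n = 1` it equals `8 ω`, which covers brute force
followed by a copy. -/
theorem depth_fft_le {ω n : ℕ} (hω : 2 ≤ ω) (hn : FFTSize ω n) :
    ∀ a t, ((fft ω n a t).depth ω : ℝ) ≤ 34 * ω * (1 + Real.logb 2 n) - 26 * ω := by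
  have hω' : (2 : ℝ) ≤ ω := by exact_mod_cast hω
  refine hn.recOn' (by omega) (motive := fun n => ∀ a t, ((fft ω n a t).depth ω : ℝ) ≤
    34 * ω * (1 + Real.logb 2 n) - 26 * ω) ?_ ?_
  · intro n hn0 hn a t
    have h1 := depth_bruteDFT_le ω n 1 a t
    have h2 := depth_copy_le ω n t a
    have h3 : (fft ω n a t).depth ω ≤ 8 * ω := by
      rw [fft_of_le hn, Prog.depth]
      omega
    have h4 : ((fft ω n a t).depth ω : ℝ) ≤ 8 * ω := by exact_mod_cast h3
    have h5 : 0 ≤ Real.logb 2 n := Real.logb_nonneg (by norm_num) (by exact_mod_cast hn0)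
    nlinarith [mul_nonneg (by linarith : (0 : ℝ) ≤ ω) h5]
  · intro m hm hs ih a t
    have h1 : (fft ω (ω * m ^ 2) a t).depth ω ≤
        2 * ⌊34 * ω * (1 + Real.logb 2 m) - 26 * ω⌋₊ + 26 * ω :=
      depth_fft_step_le hω hm (fun a t => Nat.le_floor (ih a t)) a t
    have h2 : (⌊34 * ω * (1 + Real.logb 2 m) - 26 * ω⌋₊ : ℝ) ≤
        34 * ω * (1 + Real.logb 2 m) - 26 * ω :=
      Nat.floor_le (le_trans (Nat.cast_nonneg _) (ih a t))
    have h3 : ((fft ω (ω * m ^ 2) a t).depth ω : ℝ) ≤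
        2 * ⌊34 * ω * (1 + Real.logb 2 m) - 26 * ω⌋₊ + 26 * ω := by exact_mod_cast h1
    have h4 : Real.logb 2 ((ω * m ^ 2 : ℕ) : ℝ) = Real.logb 2 ω + 2 * Real.logb 2 m := by
      push_cast
      rw [Real.logb_mul (by positivity) (by positivity), Real.logb_pow]
      norm_num
    have h5 : 1 ≤ Real.logb 2 ω := by
      rw [Real.le_logb_iff_rpow_le (by norm_num) (by linarith)]
      simpa using hω'
    rw [h4]
    nlinarith

/-- For `n ≥ 4` the logarithm is at least `2`, so `34 (1 + log n) ≤ 51 log n`, and the iterated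
logarithm is at least `1`. -/
theorem depth_fft_le_log_mul_log_log {ω n : ℕ} (hω : 2 ≤ ω) (hn : FFTSize ω n) (h4 : 4 ≤ n)
    (a t : ℕ) : ((fft ω n a t).depth ω : ℝ) ≤
      51 * (ω * Real.logb 2 n * Real.logb 2 (Real.logb 2 n)) := by
  have h := depth_fft_le hω hn a t
  have h1 : 2 ≤ Real.logb 2 n := by
    rw [Real.le_logb_iff_rpow_le (by norm_num) (by positivity)]
    norm_num
    exact_mod_cast h4
  have h2 : 1 ≤ Real.logb 2 (Real.logb 2 n) := by
    rw [Real.le_logb_iff_rpow_le (by norm_num) (by linarith)]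
    simpa using h1
  have h3 : 0 ≤ ω * Real.logb 2 n := by positivity
  nlinarith [mul_le_mul_of_nonneg_left h2 h3, mul_nonneg (Nat.cast_nonneg (α := ℝ) ω)
    (sub_nonneg.2 h1)]

/-! ### Cost of eviction policies -/

/-- From the cache contents `C`, of which `D` is dirty, the references `l` can be served at total
cost at most `z`. -/
def CostAt (cap ω : ℕ) (C D : Finset ℕ) (l : List Access) (z : ℝ) : Prop :=
  ∃ r w : ℕ, CacheRun cap C D l r w ∧ (r : ℝ) + ω * w ≤ z

section Policies

variable {cap ω : ℕ} {C D : Finset ℕ} {l l' : List Access} {z z' : ℝ}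

theorem CostAt.mono (h : CostAt cap ω C D l z) (hz : z ≤ z') : CostAt cap ω C D l z' := by
  obtain ⟨r, w, h1, h2⟩ := h
  exact ⟨r, w, h1, h2.trans hz⟩

theorem CostAt.access {a : Access} (hC : a.addr ∈ C ∨ C.card < cap)
    (h : CostAt cap ω (insert a.addr C) (if a.isWrite then insert a.addr D else D) l z) :
    CostAt cap ω C D (a :: l) (z + if a.addr ∈ C then 0 else 1) := by
  obtain ⟨r, w, h1, h2⟩ := h
  by_cases ha : a.addr ∈ C
  · rw [Finset.insert_eq_of_mem ha] at h1
    exact ⟨r, w, .hit ha h1, by simpa [ha] using h2⟩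
  · refine ⟨r + 1, w, .miss ha (hC.resolve_left ha) h1, ?_⟩
    push_cast
    simp only [ha, if_false]
    linarith

theorem CostAt.erase (hDC : D ⊆ C) (v : ℕ) (h : CostAt cap ω (C.erase v) (D.erase v) l z) :
    CostAt cap ω C D l (z + ω * if v ∈ D then 1 else 0) := by
  obtain ⟨r, w, h1, h2⟩ := h
  by_cases hv : v ∈ C
  · refine ⟨r, _, .evict hv h1, ?_⟩
    push_cast
    linarith
  · have hv' : v ∉ D := fun h => hv (hDC h)
    rw [Finset.erase_eq_of_notMem hv, Finset.erase_eq_of_notMem hv'] at h1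
    exact ⟨r, w, h1, by simpa [hv'] using h2⟩

theorem CostAt.flush (hDC : D ⊆ C) (h : CostAt cap ω ∅ ∅ l z) :
    CostAt cap ω C D l (z + ω * D.card) := by
  induction C using Finset.induction_on generalizing D with
  | empty =>
    obtain rfl := Finset.subset_empty.1 hDC
    simpa using h
  | insert v C hv ih =>
    have h1 : D.erase v ⊆ C := Finset.subset_insert_iff.1 hDC
    have h2 := ih h1
    rw [← Finset.erase_insert hv] at h2
    refine (h2.erase hDC v).mono (le_of_eq ?_)
    by_cases hvD : v ∈ D
    · rw [← Finset.card_erase_add_one hvD]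
      push_cast
      simp only [hvD, if_true]
      ring
    · simp [hvD]

/-- Nothing is evicted before the references in `l` are served: each block of `S` not yet resident
is loaded at most once. The final flush writes back at most all of `S`. -/
theorem CostAt.phase {S : Finset ℕ} (hS : S.card ≤ cap) (hl : ∀ a ∈ l, a.addr ∈ S) (hC : C ⊆ S)
    (hDC : D ⊆ C) (h : CostAt cap ω ∅ ∅ l' z) :
    CostAt cap ω C D (l ++ l') (z + ((S \ C).card + ω * S.card)) := by
  induction l generalizing C D with
  | nil =>
    refine (h.flush hDC).mono ?_
    have : (D.card : ℝ) ≤ S.card := by exact_mod_cast Finset.card_le_card (hDC.trans hC)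
    have := mul_le_mul_of_nonneg_left this (Nat.cast_nonneg (α := ℝ) ω)
    have : (0 : ℝ) ≤ (S \ C).card := Nat.cast_nonneg _
    linarith
  | cons a l ih =>
    simp only [List.forall_mem_cons] at hl
    have h1 : insert a.addr C ⊆ S := Finset.insert_subset hl.1 hC
    have h2 := ih hl.2 h1 (D := if a.isWrite then insert a.addr D else D) (by
      split_ifs
      · exact Finset.insert_subset_insert _ hDC
      · exact hDC.trans (Finset.subset_insert _ _))
    have h3 : a.addr ∈ C ∨ C.card < cap := by
      by_cases ha : a.addr ∈ C
      · exact .inl ha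
      · right
        have := Finset.card_le_card h1
        rw [Finset.card_insert_of_notMem ha] at this
        omega
    refine (h2.access h3).mono ?_
    by_cases ha : a.addr ∈ C
    · simp [ha]
    · have : (S \ insert a.addr C).card + 1 = (S \ C).card := by
        rw [Finset.sdiff_insert, Finset.card_erase_add_one]
        simp [ha, hl.1]
      rw [← this]
      push_cast
      simp only [ha, if_false]
      linarith

/-- Starting and ending with an empty cache, the references `l` cost at most `x`. -/
def CostLE (cap ω : ℕ) (l : List Access) (x : ℝ) : Prop :=
  ∀ l' z, CostAt cap ω ∅ ∅ l' z → CostAt cap ω ∅ ∅ (l ++ l') (z + x)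

variable {x y : ℝ}

theorem CostLE.mono (h : CostLE cap ω l x) (hxy : x ≤ y) : CostLE cap ω l y :=
  fun l' z hz => (h l' z hz).mono (by linarith)

theorem CostLE.nil : CostLE cap ω [] 0 := fun l' z hz => by simpa using hz

theorem CostLE.append (h : CostLE cap ω l x) (h' : CostLE cap ω l' y) :
    CostLE cap ω (l ++ l') (x + y) := fun m z hz => by
  rw [List.append_assoc, add_comm x, ← add_assoc]
  exact h _ _ (h' _ _ hz)

theorem CostLE.exists_run (h : CostLE cap ω l x) :
    ∃ r w, CacheRun cap ∅ ∅ l r w ∧ (r : ℝ) + ω * w ≤ x := by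
  have := h [] 0 ⟨0, 0, .done ∅ ∅, by simp⟩
  simpa [CostAt] using this

/-- References to few blocks can be served by loading each of these blocks once. -/
theorem CostLE.phase {S : Finset ℕ} (hS : S.card ≤ cap) (hl : ∀ a ∈ l, a.addr ∈ S) :
    CostLE cap ω l ((1 + ω) * S.card) := fun l' z hz => by
  refine (CostAt.phase hS hl (Finset.empty_subset S) subset_rfl hz).mono (le_of_eq ?_)
  rw [Finset.sdiff_empty]
  ring

theorem CostLE.singleton (hcap : 1 ≤ cap) (a : Access) :
    CostLE cap ω [a] (1 + if a.isWrite then (ω : ℝ) else 0) := fun l' z hz => by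
  refine (CostAt.access (.inr (by rw [Finset.card_empty]; omega)) (CostAt.flush (D :=
    if a.isWrite then insert a.addr ∅ else ∅) ?_ hz)).mono ?_
  · split_ifs <;> simp
  · cases a.isWrite <;> simp
    linarith

/-! #### Two heads -/

/-- The addresses read in a list of references. -/
def readAddrs (l : List Access) : List ℕ := (l.filter fun a => !a.isWrite).map Access.addr

/-- The addresses written in a list of references. -/
def writeAddrs (l : List Access) : List ℕ := (l.filter fun a => a.isWrite).map Access.addr

/-- The number of moves of a head that starts at `x` and visits the blocks in the list. -/
def moves : ℕ → List ℕ → ℕ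
  | _, [] => 0
  | x, a :: l => (if a = x then 0 else 1) + moves a l

/-- The cost of loading the block `x` into the cache `C`. -/
noncomputable def missCost (x : ℕ) (C : Finset ℕ) : ℝ := if x ∈ C then 0 else 1

theorem missCost_nonneg (x : ℕ) (C : Finset ℕ) : 0 ≤ missCost x C := by
  rw [missCost]; split_ifs <;> norm_num

theorem missCost_le_one (x : ℕ) (C : Finset ℕ) : missCost x C ≤ 1 := by
  rw [missCost]; split_ifs <;> norm_num

theorem missCost_insert_self (x : ℕ) (C : Finset ℕ) : missCost x (insert x C) = 0 := by
  simp [missCost]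

theorem missCost_le {x : ℕ} {C C' : Finset ℕ} (h : x ∈ C → x ∈ C') :
    missCost x C' ≤ missCost x C := by
  rw [missCost, missCost]
  by_cases hx : x ∈ C
  · rw [if_pos hx, if_pos (h hx)]
  · rw [if_neg hx]; split_ifs <;> norm_num

theorem card_le_one_of_subset {T : Finset ℕ} {v : ℕ} (hT : T ⊆ {v}) : T.card ≤ 1 := by
  simpa using Finset.card_le_card hT

theorem subset_singleton_of_notMem {T : Finset ℕ} {u v : ℕ} (hT : T ⊆ {u, v}) (hu : u ∉ T) :
    T ⊆ {v} := fun w hw => by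
  rcases Finset.mem_insert.1 (hT hw) with rfl | h
  · exact absurd hw hu
  · exact h

theorem mem_or_card_lt {T : Finset ℕ} {u v : ℕ} (hcap : 2 ≤ cap) (hT : T ⊆ {u, v}) :
    u ∈ T ∨ T.card < cap := by
  by_cases hu : u ∈ T
  · exact .inl hu
  · have := card_le_one_of_subset (subset_singleton_of_notMem hT hu)
    exact .inr (by omega)

/-- The policy keeps only the block `x` of a read head and the block `y` of a write head, and only
`y` can be dirty. The terms with `missCost` act as a potential for heads whose block is not
resident, and the last `ω` pays for the final flush. A move of the read head costs one load. A move
of the write head costs a write-back `ω`, a load, and possibly a reload of `x` if both heads stood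
on the same block, whence `2 + ω`. -/
theorem CostAt.heads (hcap : 2 ≤ cap) {x y : ℕ} (hDC : D ⊆ C) (hC : C ⊆ {x, y}) (hD : D ⊆ {y})
    (h : CostAt cap ω ∅ ∅ l' z) :
    CostAt cap ω C D (l ++ l') (z + (moves x (readAddrs l) + (2 + ω) * moves y (writeAddrs l) +
      missCost x C + (2 + ω) * missCost y C + ω)) := by
  have hω : (0 : ℝ) ≤ ω := Nat.cast_nonneg _
  induction l generalizing C D x y with
  | nil =>
    refine (h.flush hDC).mono ?_
    have h1 : (D.card : ℝ) ≤ 1 := by exact_mod_cast card_le_one_of_subset hD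
    have h2 := mul_le_mul_of_nonneg_left h1 hω
    have h3 := missCost_nonneg x C
    have h4 : 0 ≤ (2 + ω) * missCost y C := mul_nonneg (by linarith) (missCost_nonneg y C)
    simp only [readAddrs, writeAddrs, moves, List.filter_nil, List.map_nil, Nat.cast_zero]
    linarith
  | cons a l ih =>
    obtain ⟨b, a⟩ := a
    cases b
    · have e1 : readAddrs (⟨false, a⟩ :: l) = a :: readAddrs l := rfl
      have e2 : writeAddrs (⟨false, a⟩ :: l) = writeAddrs l := rfl
      rw [e1, e2, moves]
      by_cases hax : a = x
      · subst hax
        have h1 := ih (x := a) (y := y) (C := insert a C) (D := D)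
          (hDC.trans (Finset.subset_insert _ _)) (Finset.insert_subset (by simp) hC) hD
        refine (CostAt.access (a := ⟨false, a⟩) (mem_or_card_lt hcap hC) h1).mono ?_
        have h2 : missCost y (insert a C) ≤ missCost y C := missCost_le Finset.mem_insert_of_mem
        have h3 := mul_le_mul_of_nonneg_left h2 (by linarith : (0 : ℝ) ≤ 2 + ω)
        change _ + missCost a C ≤ _
        rw [missCost_insert_self, if_pos rfl, Nat.zero_add]
        linarith
      · have h1 : C ∩ {y} ⊆ {y} := Finset.inter_subset_right
        have h2 := ih (x := a) (y := y) (C := insert a (C ∩ {y})) (D := D)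
          ((Finset.subset_inter hDC hD).trans (Finset.subset_insert _ _))
          (Finset.insert_subset_insert _ h1) hD
        have h3 := card_le_one_of_subset h1
        have h4 := CostAt.access (a := ⟨false, a⟩) (C := C ∩ {y}) (.inr (by omega)) h2
        have h5 := missCost_le_one a (C ∩ {y})
        have h6 : missCost y (insert a (C ∩ {y})) ≤ missCost y C :=
          missCost_le fun hy => by simp [hy]
        have h7 := mul_le_mul_of_nonneg_left h6 (by linarith : (0 : ℝ) ≤ 2 + ω)
        have h8 := missCost_nonneg x C
        change CostAt cap ω _ _ _ (_ + missCost a (C ∩ {y})) at h4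
        rw [missCost_insert_self] at h4
        rw [if_neg hax]
        push_cast
        -- If both heads share a block, it stays for the write head. Otherwise the old block of the
        -- read head is clean and is evicted for free.
        by_cases hxy : x = y
        · subst hxy
          rw [Finset.inter_eq_left.2 (by simpa using hC)] at h4 h5 h7
          exact h4.mono (by linarith)
        · have hxD : x ∉ D := fun hx => hxy (by simpa using hD hx)
          have e3 : C.erase x = C ∩ {y} := by
            ext u
            have := @hC u
            simp only [Finset.mem_insert, Finset.mem_singleton, Finset.mem_erase,
              Finset.mem_inter] at this ⊢
            grind
          rw [← e3] at h4 h5 h7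
          have h9 := CostAt.erase hDC x (by rwa [Finset.erase_eq_of_notMem hxD])
          rw [if_neg hxD] at h9
          exact h9.mono (by linarith)
    · have e1 : readAddrs (⟨true, a⟩ :: l) = readAddrs l := rfl
      have e2 : writeAddrs (⟨true, a⟩ :: l) = a :: writeAddrs l := rfl
      rw [e1, e2, moves]
      by_cases hay : a = y
      · subst hay
        have h1 := ih (x := x) (y := a) (C := insert a C) (D := insert a D)
          (Finset.insert_subset_insert _ hDC) (Finset.insert_subset (by simp) hC)
          (Finset.insert_subset (by simp) hD)
        refine (CostAt.access (a := ⟨true, a⟩)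
          (mem_or_card_lt hcap (by rwa [Finset.pair_comm])) h1).mono ?_
        have h2 : missCost x (insert a C) ≤ missCost x C := missCost_le Finset.mem_insert_of_mem
        have h3 : missCost a C ≤ (2 + ω) * missCost a C :=
          le_mul_of_one_le_left (missCost_nonneg a C) (by linarith)
        change _ + missCost a C ≤ _
        rw [missCost_insert_self, if_pos rfl, Nat.zero_add]
        linarith
      · have h1 : C.erase y ⊆ {x} :=
          subset_singleton_of_notMem (u := y)
            ((Finset.erase_subset _ _).trans (by rwa [Finset.pair_comm])) (Finset.notMem_erase _ _)
        have h2 : D.erase y = ∅ := by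
          rw [Finset.erase_eq_empty_iff]
          exact Finset.subset_singleton_iff.1 hD
        have h3 := ih (x := x) (y := a) (C := insert a (C.erase y)) (D := insert a (D.erase y))
          (Finset.insert_subset_insert _ (Finset.erase_subset_erase _ hDC))
          (by rw [Finset.pair_comm]; exact Finset.insert_subset_insert _ h1) (by simp [h2])
        have h4 := card_le_one_of_subset h1
        refine (CostAt.erase hDC y
          (CostAt.access (a := ⟨true, a⟩) (.inr (by omega)) h3)).mono ?_
        have h5 := missCost_le_one a (C.erase y)
        have h6 := missCost_le_one x (insert a (C.erase y))
        have h7 := missCost_nonneg x C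
        have h8 : 0 ≤ (2 + ω) * missCost y C := mul_nonneg (by linarith) (missCost_nonneg y C)
        have h9 : (ω : ℝ) * (if y ∈ D then 1 else 0) ≤ ω := by split_ifs <;> simp
        change _ + missCost a (C.erase y) + _ ≤ _
        rw [missCost_insert_self, if_neg hay]
        push_cast
        linarith

theorem CostLE.heads (hcap : 2 ≤ cap) : CostLE cap ω l (moves 0 (readAddrs l) +
    (2 + ω) * moves 0 (writeAddrs l) + (3 + 2 * ω)) := fun l' z hz => by
  refine (CostAt.heads hcap subset_rfl (Finset.empty_subset {0, 0}) (Finset.empty_subset {0})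
    hz).mono (le_of_eq ?_)
  simp only [missCost, Finset.notMem_empty, if_false]
  ring

end Policies

/-! #### Counting moves -/

theorem moves_le_succ (x x' : ℕ) (l : List ℕ) : moves x l ≤ moves x' l + 1 := by
  cases l with
  | nil => simp [moves]
  | cons a l => simp only [moves]; split_ifs <;> omega

theorem exists_moves_append (x : ℕ) (l₁ l₂ : List ℕ) :
    ∃ y, moves x (l₁ ++ l₂) = moves x l₁ + moves y l₂ := by
  induction l₁ generalizing x with
  | nil => exact ⟨x, by simp [moves]⟩
  | cons a l ih =>
    obtain ⟨y, hy⟩ := ih a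
    exact ⟨y, by simp only [List.cons_append, moves, hy]; omega⟩

theorem moves_flatMap_le {f : ℕ → List ℕ} {k c : ℕ} (h : ∀ i < k, ∀ x, moves x (f i) ≤ c)
    (x : ℕ) : moves x ((List.range k).flatMap f) ≤ k * c := by
  induction k generalizing x with
  | zero => simp [moves]
  | succ k ih =>
    rw [List.range_succ, List.flatMap_append]
    obtain ⟨y, hy⟩ := exists_moves_append x ((List.range k).flatMap f) ([k].flatMap f)
    have h1 := ih (fun i hi => h i (by omega)) x
    have h2 := h k (by omega) y
    rw [hy, add_mul, one_mul, List.flatMap_singleton]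
    omega

/-- The words `e, …, e + N - 1` in blocks of `B` words. -/
theorem moves_scan_aux (B e N : ℕ) :
    moves (e / B) ((List.range N).map fun u => (e + u) / B) + e / B ≤ (e + N) / B := by
  induction N generalizing e with
  | zero => simp [moves]
  | succ N ih =>
    have h1 := ih (e + 1)
    have h2 := moves_le_succ (e / B) ((e + 1) / B) ((List.range N).map fun u => (e + 1 + u) / B)
    have h3 : e / B ≤ (e + 1) / B := Nat.div_le_div_right (by omega)
    rw [List.range_succ_eq_map, List.map_cons, List.map_map, add_zero, moves, if_pos rfl, zero_add]
    have e1 : ((fun u => (e + u) / B) ∘ Nat.succ) = fun u => (e + 1 + u) / B := by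
      funext u
      simp only [Function.comp, Nat.succ_eq_add_one]
      congr 1
      omega
    rw [e1, show e + (N + 1) = e + 1 + N by omega]
    rcases Nat.eq_or_lt_of_le h3 with h | h
    · rw [← h] at h1
      exact h1
    · omega

theorem add_div_le (e N : ℕ) {B : ℕ} (hB : 0 < B) : (e + N) / B ≤ e / B + N / B + 1 := by
  have h1 := Nat.div_add_mod e B
  have h2 := Nat.div_add_mod N B
  have h3 := Nat.mod_lt e hB
  have h4 := Nat.mod_lt N hB
  rw [← Nat.lt_succ_iff, Nat.div_lt_iff_lt_mul hB]
  have : (e / B + N / B + 1).succ * B = B * (e / B) + B * (N / B) + 2 * B := by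
    rw [Nat.succ_eq_add_one]; ring
  omega

theorem moves_scan {B : ℕ} (hB : 0 < B) (e N x : ℕ) :
    moves x ((List.range N).map fun u => (e + u) / B) ≤ N / B + 2 := by
  have h1 := moves_scan_aux B e N
  have h2 := moves_le_succ x (e / B) ((List.range N).map fun u => (e + u) / B)
  have h3 := add_div_le e N hB
  omega

/-! ### Cost of programs -/

/-- Starting and ending with an empty cache, running `p` costs at most `x`. -/
def Prog.CostLE (cap ω B : ℕ) (p : Prog) (x : ℝ) : Prop :=
  AsymFFT.CostLE cap ω (p.blockTrace B) x

section Costs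

variable {cap ω B : ℕ} {x y : ℝ}

theorem Prog.CostLE.mono {p : Prog} (h : p.CostLE cap ω B x) (hxy : x ≤ y) : p.CostLE cap ω B y :=
  AsymFFT.CostLE.mono h hxy

theorem Prog.CostLE.seq {p q : Prog} (hp : p.CostLE cap ω B x) (hq : q.CostLE cap ω B y) :
    (Prog.seq p q).CostLE cap ω B (x + y) := by
  have := AsymFFT.CostLE.append hp hq
  rwa [blockTrace, blockTrace, ← List.map_append] at this

theorem Prog.CostLE.par {p q : Prog} (hp : p.CostLE cap ω B x) (hq : q.CostLE cap ω B y) :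
    (AsymFFT.par p q).CostLE cap ω B (x + y) := by
  have := AsymFFT.CostLE.append hp hq
  rwa [blockTrace, blockTrace, ← List.map_append, ← trace_par] at this

theorem Prog.blockTrace_parFor_add (k k' : ℕ) (body : ℕ → Prog) :
    (Prog.parFor (k + k') body).blockTrace B = (Prog.parFor k body).blockTrace B ++
      (Prog.parFor k' fun i => body (k + i)).blockTrace B := by
  simp only [blockTrace, trace, List.range_add, List.flatMap_append, List.map_append,
    List.flatMap_map]

theorem Prog.CostLE.parFor_add {k k' : ℕ} {body : ℕ → Prog}
    (h : (Prog.parFor k body).CostLE cap ω B x)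
    (h' : (Prog.parFor k' fun i => body (k + i)).CostLE cap ω B y) :
    (Prog.parFor (k + k') body).CostLE cap ω B (x + y) := by
  rw [CostLE, blockTrace_parFor_add]
  exact AsymFFT.CostLE.append h h'

theorem Prog.CostLE.parFor {k : ℕ} {body : ℕ → Prog} (h : ∀ i < k, (body i).CostLE cap ω B x) :
    (Prog.parFor k body).CostLE cap ω B (k * x) := by
  induction k with
  | zero => simpa [CostLE, blockTrace, trace] using AsymFFT.CostLE.nil (cap := cap) (ω := ω)
  | succ k ih =>
    refine (CostLE.parFor_add (k' := 1) (y := x) (ih fun i hi => h i (by omega)) ?_).mono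
      (by push_cast; linarith)
    simpa [CostLE, blockTrace, trace] using h k (by omega)

theorem Prog.readAddrs_trace (p : Prog) : readAddrs p.trace = p.reads := by
  induction p with
  | comb dst ts => simp [readAddrs, trace, reads, List.filter_map, Function.comp_def]
  | seq p q hp hq =>
    rw [trace, reads, ← hp, ← hq]
    simp [readAddrs]
  | parFor k body ih =>
    rw [trace, reads]
    simp only [← ih]
    simp [readAddrs, List.filter_flatMap, List.map_flatMap]

theorem Prog.writeAddrs_trace (p : Prog) : writeAddrs p.trace = p.writes := by
  induction p with
  | comb dst ts => simp [writeAddrs, trace, writes, List.filter_map, Function.comp_def]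
  | seq p q hp hq =>
    rw [trace, writes, ← hp, ← hq]
    simp [writeAddrs]
  | parFor k body ih =>
    rw [trace, writes]
    simp only [← ih]
    simp [writeAddrs, List.filter_flatMap, List.map_flatMap]

theorem Prog.readAddrs_blockTrace (p : Prog) :
    readAddrs (p.blockTrace B) = p.reads.map (· / B) := by
  rw [← readAddrs_trace]
  simp [readAddrs, blockTrace, List.filter_map, Function.comp_def]

theorem Prog.writeAddrs_blockTrace (p : Prog) :
    writeAddrs (p.blockTrace B) = p.writes.map (· / B) := by
  rw [← writeAddrs_trace]
  simp [writeAddrs, blockTrace, List.filter_map, Function.comp_def]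

theorem Prog.CostLE.heads (hcap : 2 ≤ cap) (p : Prog) :
    p.CostLE cap ω B (moves 0 (p.reads.map (· / B)) + (2 + ω) * moves 0 (p.writes.map (· / B)) +
      (3 + 2 * ω)) := by
  have := AsymFFT.CostLE.heads (ω := ω) (l := p.blockTrace B) hcap
  rwa [readAddrs_blockTrace, writeAddrs_blockTrace] at this

/-- The cache is flushed after every reference. This crude policy serves for caches of fewer than
ten blocks, where tallness bounds `B` by a constant. -/
theorem Prog.CostLE.eachAccess (hcap : 1 ≤ cap) (p : Prog) :
    p.CostLE cap ω B (p.reads.length + (1 + ω) * p.writes.length) := by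
  have aux : ∀ l : List Access, AsymFFT.CostLE cap ω l
      ((readAddrs l).length + (1 + ω) * (writeAddrs l).length) := by
    intro l
    induction l with
    | nil => simpa [readAddrs, writeAddrs] using AsymFFT.CostLE.nil
    | cons a l ih =>
      refine (AsymFFT.CostLE.append (CostLE.singleton hcap a) ih).mono ?_
      obtain ⟨b, a⟩ := a
      cases b <;> simp [readAddrs, writeAddrs] <;> linarith
  have := aux (p.blockTrace B)
  rwa [readAddrs_blockTrace, writeAddrs_blockTrace, List.length_map, List.length_map] at this

theorem Prog.CostLE.phase {p : Prog} {S : Finset ℕ} (hS : S.card ≤ cap)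
    (hr : ∀ u ∈ p.reads, u / B ∈ S) (hw : ∀ u ∈ p.writes, u / B ∈ S) :
    p.CostLE cap ω B ((1 + ω) * S.card) := by
  refine AsymFFT.CostLE.phase hS fun a ha => ?_
  obtain ⟨⟨b, u⟩, hu, rfl⟩ := List.mem_map.1 ha
  cases b
  · exact hr u (mem_trace_false.1 hu)
  · exact hw u (mem_trace_true.1 hu)

/-- The blocks that contain the `N` words from `a`. -/
def blocks (B a N : ℕ) : Finset ℕ := Finset.Icc (a / B) ((a + N) / B)

theorem card_blocks_le (hB : 0 < B) (a N : ℕ) : (blocks B a N).card ≤ N / B + 2 := by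
  have := add_div_le a N hB
  rw [blocks, Nat.card_Icc]
  generalize N / B = d at *
  generalize a / B = c at *
  omega

theorem div_mem_blocks {a N u : ℕ} (h : a ≤ u ∧ u < a + N) : u / B ∈ blocks B a N :=
  Finset.mem_Icc.2 ⟨Nat.div_le_div_right h.1, Nat.div_le_div_right h.2.le⟩

/-- A program that touches few blocks in all. -/
theorem Prog.CostLE.of_within {p : Prog} (hB : 0 < B) {a t N : ℕ} (h : p.Within a t N)
    (hN : 2 * (N / B + 2) ≤ cap) : p.CostLE cap ω B ((1 + ω) * (2 * (N / B + 2))) := by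
  have h1 := Finset.card_union_le (blocks B a N) (blocks B t N)
  have h2 := card_blocks_le hB a N
  have h3 := card_blocks_le hB t N
  have h4 : ∀ u, u ∈ p.reads ∨ u ∈ p.writes → u / B ∈ blocks B a N ∪ blocks B t N := by
    intro u hu
    rw [Finset.mem_union]
    exact (h u hu).imp div_mem_blocks div_mem_blocks
  refine (CostLE.phase (S := blocks B a N ∪ blocks B t N) (by omega) (fun u hu => h4 u (.inl hu))
    fun u hu => h4 u (.inr hu)).mono ?_
  have h5 : ((blocks B a N ∪ blocks B t N).card : ℝ) ≤ 2 * ((N / B : ℕ) + 2) := by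
    exact_mod_cast (by omega : (blocks B a N ∪ blocks B t N).card ≤ 2 * (N / B + 2))
  have h6 : ((N / B : ℕ) : ℝ) ≤ N / B := Nat.cast_div_le
  exact mul_le_mul_of_nonneg_left (by linarith) (by positivity)

end Costs

/-! ### Cost of the building blocks -/

theorem flatMap_range_map (k m : ℕ) (f : ℕ → ℕ) :
    ((List.range k).flatMap fun i => (List.range m).map fun j => f (i * m + j)) =
      (List.range (k * m)).map f := by
  induction k with
  | zero => simp
  | succ k ih =>
    rw [List.range_succ, List.flatMap_append, ih, add_mul, one_mul, List.range_add,
      List.map_append, List.flatMap_singleton, List.map_map]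
    rfl

theorem reads_twiddle (k m N : ℕ) (e : ℕ → ℕ → ℕ) (s : ℕ) :
    (twiddle k m N e s).reads = (List.range (k * m)).map (s + ·) := by
  rw [← flatMap_range_map]
  simp only [twiddle, Prog.reads, List.map_cons, List.map_nil, ← List.map_eq_flatMap, add_assoc]

theorem writes_twiddle (k m N : ℕ) (e : ℕ → ℕ → ℕ) (s : ℕ) :
    (twiddle k m N e s).writes = (List.range (k * m)).map (s + ·) := by
  rw [← flatMap_range_map]
  simp only [twiddle, Prog.writes, ← List.map_eq_flatMap, add_assoc]

theorem writes_bruteDFT (k m s d : ℕ) :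
    (bruteDFT k m s d).writes = (List.range (k * m)).map (d + ·) := by
  rw [← flatMap_range_map]
  simp only [bruteDFT, Prog.writes, ← List.map_eq_flatMap, add_assoc]

/-- The output row is the outer loop, so the reads form `k` consecutive scans of the whole input. -/
theorem reads_bruteDFT (k m s d : ℕ) : (bruteDFT k m s d).reads =
    (List.range k).flatMap fun _ => (List.range (k * m)).map (s + ·) := by
  rw [mul_comm k m, ← flatMap_range_map]
  simp only [bruteDFT, Prog.reads, List.map_map, Function.comp_def, add_assoc]

theorem length_reads_transpose (p q s ss d ds : ℕ) :
    (transpose p q s ss d ds).reads.length = p * q := by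
  induction p, q, s, d using transpose.induct ss ds with
  | case1 p q s d h =>
    rw [transpose, if_pos h, reads_copy]
    rcases h with rfl | rfl <;> simp
  | case2 p q s d h h' =>
    rw [transpose, if_neg h, if_pos h', reads_copy]
    simp [h']
  | case3 p q s d h h' hqp ih1 ih2 =>
    rw [transpose, if_neg h, if_neg h', if_pos hqp, reads_par, List.length_append, ih1, ih2,
      ← add_mul]
    congr 1
    omega
  | case4 p q s d h h' hqp ih1 ih2 =>
    rw [transpose, if_neg h, if_neg h', if_neg hqp, reads_par, List.length_append, ih1, ih2,
      ← mul_add]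
    congr 1
    omega

theorem length_writes_transpose (p q s ss d ds : ℕ) :
    (transpose p q s ss d ds).writes.length = p * q := by
  induction p, q, s, d using transpose.induct ss ds with
  | case1 p q s d h =>
    rw [transpose, if_pos h, writes_copy]
    rcases h with rfl | rfl <;> simp
  | case2 p q s d h h' =>
    rw [transpose, if_neg h, if_pos h', writes_copy]
    simp [h']
  | case3 p q s d h h' hqp ih1 ih2 =>
    rw [transpose, if_neg h, if_neg h', if_pos hqp, writes_par, List.length_append, ih1, ih2,
      ← add_mul]
    congr 1
    omega
  | case4 p q s d h h' hqp ih1 ih2 =>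
    rw [transpose, if_neg h, if_neg h', if_neg hqp, writes_par, List.length_append, ih1, ih2,
      ← mul_add]
    congr 1
    omega

/-! #### Transposition in a tall cache -/

/-- The blocks of a `p × q` matrix of at most `S²` words, `S ≤ B`, that is contiguous or not much
longer than wide. -/
theorem exists_blocks_matrix {B S : ℕ} (hB : 0 < B) (hS : 0 < S) (hSB : S ≤ B) {p q s ss : ℕ}
    (hpq : p * q ≤ S ^ 2) (hq : 0 < q) (h : p ≤ 3 * q ∨ ss = q) :
    ∃ F : Finset ℕ, (∀ i < p, ∀ j < q, (s + i * ss + j) / B ∈ F) ∧ F.card ≤ 5 * S := by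
  have h1 : p * q / B ≤ S := by
    refine Nat.div_le_of_le_mul (hpq.trans ?_)
    rw [sq]
    exact Nat.mul_le_mul_right S hSB
  rcases h with h | rfl
  · refine ⟨(Finset.range p).biUnion fun i => blocks B (s + i * ss) q, fun i hi j hj => ?_, ?_⟩
    · exact Finset.mem_biUnion.2 ⟨i, Finset.mem_range.2 hi, div_mem_blocks (by omega)⟩
    -- From `p ≤ 3 q` it follows that `p² ≤ 3 p q ≤ 3 S² < (2 S)²`. The `p` rows then meet at most
    -- `S + 2 p ≤ 5 S` blocks.
    · have h2 : p ≤ 2 * S := by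
        by_contra! hlt
        have : p * p ≤ 3 * (p * q) := by nlinarith
        nlinarith
      have h3 : p * (q / B) ≤ p * q / B := Nat.mul_div_le_mul_div_assoc p q B
      calc _ ≤ (Finset.range p).card * (q / B + 2) :=
            Finset.card_biUnion_le_card_mul _ _ _ fun i _ => card_blocks_le hB _ _
        _ = p * (q / B) + 2 * p := by rw [Finset.card_range]; ring
        _ ≤ 5 * S := by omega
  · refine ⟨blocks B s (p * ss), fun i hi j hj => div_mem_blocks ?_, ?_⟩
    · have := mul_add_lt hi hj
      omega
    · have := card_blocks_le hB s (p * ss)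
      omega

theorem cost_transpose_small {cap ω B S : ℕ} (hB : 0 < B) (hS : 0 < S) (hSB : S ≤ B)
    (hcap : 10 * S ≤ cap) {p q s ss d ds : ℕ} (hp : 0 < p) (hq : 0 < q) (hpq : p * q ≤ S ^ 2)
    (h : p ≤ 3 * q ∨ ss = q) (h' : q ≤ 3 * p ∨ ds = p) :
    (transpose p q s ss d ds).CostLE cap ω B ((1 + ω) * (10 * S)) := by
  obtain ⟨F, hF, hFc⟩ := exists_blocks_matrix (s := s) hB hS hSB hpq hq h
  obtain ⟨G, hG, hGc⟩ := exists_blocks_matrix (s := d) hB hS hSB (mul_comm p q ▸ hpq) hp h'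
  have h1 := Finset.card_union_le F G
  refine (Prog.CostLE.phase (S := F ∪ G) (by omega) (fun u hu => ?_) fun u hu => ?_).mono ?_
  · obtain ⟨i, hi, j, hj, rfl⟩ := exists_of_mem_reads_transpose hu
    exact Finset.mem_union_left _ (hF i hi j hj)
  · obtain ⟨i, hi, j, hj, rfl⟩ := exists_of_mem_writes_transpose hu
    exact Finset.mem_union_right _ (hG j hj i hi)
  · have h2 : ((F ∪ G).card : ℝ) ≤ 10 * S := by
      exact_mod_cast (by omega : (F ∪ G).card ≤ 10 * S)
    exact mul_le_mul_of_nonneg_left h2 (by positivity)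

/-- The recursion is followed down to areas at most `S²`. Halving a side of length at least `2`
keeps a third of the area, so these pieces have area at least `S² / 3` and the cost `10 S` of each
is at most `30 / S` per word. A split destroys the contiguity of one of the two matrices. The halved
side was the longer one, so the aspect condition of that matrix, with factor `3`, holds from then
on. -/
theorem cost_transpose_large {cap ω B S : ℕ} (hB : 0 < B) (hS : 0 < S) (hSB : S ≤ B)
    (hcap : 10 * S ≤ cap) {p q s ss d ds : ℕ} (hp : 0 < p) (hq : 0 < q)
    (hpq : S ^ 2 ≤ 3 * (p * q)) (h : p ≤ 3 * q ∨ ss = q) (h' : q ≤ 3 * p ∨ ds = p) :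
    (transpose p q s ss d ds).CostLE cap ω B ((1 + ω) * (30 * (p * q : ℕ) / S)) := by
  have hS' : (0 : ℝ) < S := by exact_mod_cast hS
  have small {p q s d : ℕ} (hp : 0 < p) (hq : 0 < q) (hpq : S ^ 2 ≤ 3 * (p * q))
      (h : p ≤ 3 * q ∨ ss = q) (h' : q ≤ 3 * p ∨ ds = p) (h3 : p * q ≤ S ^ 2) :
      (transpose p q s ss d ds).CostLE cap ω B ((1 + ω) * (30 * (p * q : ℕ) / S)) := by
    refine (cost_transpose_small hB hS hSB hcap hp hq h3 h h').mono
      (mul_le_mul_of_nonneg_left ?_ (by positivity))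
    rw [le_div_iff₀ hS']
    have : (S : ℝ) ^ 2 ≤ 3 * (p * q : ℕ) := by exact_mod_cast hpq
    nlinarith
  induction p, q, s, d using transpose.induct ss ds with
  | case1 p q s d h0 => omega
  | case2 p q s d h0 h1 =>
    obtain ⟨rfl, rfl⟩ := h1
    exact small hp hq hpq h h' (by simpa using Nat.one_le_pow 2 S hS)
  | case3 p q s d h0 h1 hqp ih1 ih2 =>
    rcases le_or_gt (p * q) (S ^ 2) with h3 | h3
    · exact small hp hq hpq h h' h3
    · have hp2 : 2 ≤ p := by omega
      have h4 : p * q ≤ 3 * (p / 2 * q) := by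
        rw [← mul_assoc]; exact Nat.mul_le_mul_right q (by omega)
      have h5 : p * q ≤ 3 * ((p - p / 2) * q) := by
        rw [← mul_assoc]; exact Nat.mul_le_mul_right q (by omega)
      rw [transpose, if_neg h0, if_neg h1, if_pos hqp]
      refine (Prog.CostLE.par (ih1 (by omega) hq (by omega) (by omega) (by omega))
        (ih2 (by omega) hq (by omega) (by omega) (by omega))).mono (le_of_eq ?_)
      have h6 : p * q = p / 2 * q + (p - p / 2) * q := by rw [← add_mul]; congr 1; omega
      rw [h6]
      push_cast
      ring
  | case4 p q s d h0 h1 hqp ih1 ih2 =>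
    rcases le_or_gt (p * q) (S ^ 2) with h3 | h3
    · exact small hp hq hpq h h' h3
    · have h4 : p * q ≤ 3 * (p * (q / 2)) := by
        rw [mul_left_comm]; exact Nat.mul_le_mul_left p (by omega)
      have h5 : p * q ≤ 3 * (p * (q - q / 2)) := by
        rw [mul_left_comm]; exact Nat.mul_le_mul_left p (by omega)
      rw [transpose, if_neg h0, if_neg h1, if_neg hqp]
      refine (Prog.CostLE.par (ih1 hp (by omega) (by omega) (by omega) (by omega))
        (ih2 hp (by omega) (by omega) (by omega) (by omega))).mono (le_of_eq ?_)
      have h6 : p * q = p * (q / 2) + p * (q - q / 2) := by rw [← mul_add]; congr 1; omega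
      rw [h6]
      push_cast
      ring

/-! #### Costs of the building blocks under the tall-cache assumption -/

/-- A cache of `cap` blocks of `B` words is tall. -/
structure Tall (K : ℝ) (cap B : ℕ) : Prop where
  one_le : 1 ≤ K
  block_pos : 0 < B
  cap_pos : 1 ≤ cap
  block_le : (B : ℝ) ≤ K * max 1 (cap / 10 : ℕ)

section Blocks

variable {K : ℝ} {cap ω B : ℕ}

/-- A bound for the cost of an operation on `N` contiguous words. -/
noncomputable def opCost (K : ℝ) (ω B N : ℕ) : ℝ := 45 * K * ω * (N / B + 1)

/-- With fewer than ten blocks, tallness gives `B ≤ K`, so a cost per word is within the factor `K`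
of a cost per block. -/
theorem Tall.le_opCost_of_cap_lt (hT : Tall K cap B) (hcap : cap < 10) {N : ℕ} {x : ℝ}
    (hx : x ≤ 3 * ω * N) : x ≤ opCost K ω B N := by
  have hB : (0 : ℝ) < B := by exact_mod_cast hT.block_pos
  have h1 : (B : ℝ) ≤ K := by
    have := hT.block_le
    rw [Nat.div_eq_of_lt hcap] at this
    simpa using this
  have h2 : (N : ℝ) = B * (N / B) := by field_simp
  have h3 : (B : ℝ) * (N / B) ≤ K * (N / B) := mul_le_mul_of_nonneg_right h1 (by positivity)
  have h4 : (0 : ℝ) ≤ K * ω := mul_nonneg (by linarith [hT.one_le]) (Nat.cast_nonneg _)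
  have h5 : (0 : ℝ) ≤ K * ω * (N / B) := mul_nonneg h4 (by positivity)
  have h6 : (ω : ℝ) * N ≤ ω * (K * (N / B)) :=
    mul_le_mul_of_nonneg_left (h2.trans_le h3) (Nat.cast_nonneg _)
  rw [opCost]
  nlinarith

theorem Tall.le_opCost (hT : Tall K cap B) {N : ℕ} {x : ℝ} (hx : x ≤ 45 * ω * (N / B + 1)) :
    x ≤ opCost K ω B N := by
  refine hx.trans ?_
  have h1 : (0 : ℝ) ≤ 45 * ω * (N / B + 1) := by positivity
  rw [opCost]
  nlinarith [hT.one_le]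

/-- This is where the asymmetry is exploited: up to `ω` sweeps of cheap reads and a single sweep of
writes each contribute `O(ω (N / B + 1))`. -/
theorem cost_of_scan (hT : Tall K cap B) (hω : 2 ≤ ω) {p : Prog} {k N d : ℕ} (hk : k ≤ ω)
    (hr : ∀ x, moves x (p.reads.map (· / B)) ≤ k * (N / B + 2)) (hr' : p.reads.length ≤ k * N)
    (hw : p.writes = (List.range N).map (d + ·)) : p.CostLE cap ω B (opCost K ω B N) := by
  have hω' : (2 : ℝ) ≤ ω := by exact_mod_cast hω
  have hk' : (k : ℝ) ≤ ω := by exact_mod_cast hk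
  rcases Nat.lt_or_ge cap 10 with hcap | hcap
  · refine (Prog.CostLE.eachAccess hT.cap_pos p).mono (hT.le_opCost_of_cap_lt hcap ?_)
    have h1 : (p.reads.length : ℝ) ≤ k * N := by exact_mod_cast hr'
    have h2 : (k : ℝ) * N ≤ ω * N := mul_le_mul_of_nonneg_right hk' (Nat.cast_nonneg _)
    have h3 : (2 : ℝ) * N ≤ ω * N := mul_le_mul_of_nonneg_right hω' (Nat.cast_nonneg _)
    rw [hw, List.length_map, List.length_range]
    linarith
  · refine (Prog.CostLE.heads (by omega) p).mono (hT.le_opCost ?_)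
    have h1 : (moves 0 (p.reads.map (· / B)) : ℝ) ≤ k * ((N / B : ℕ) + 2) := by
      exact_mod_cast hr 0
    have h2 : moves 0 (p.writes.map (· / B)) ≤ N / B + 2 := by
      rw [hw, List.map_map]
      exact moves_scan hT.block_pos d N 0
    have h3 : (moves 0 (p.writes.map (· / B)) : ℝ) ≤ (N / B : ℕ) + 2 := by exact_mod_cast h2
    have h4 : ((N / B : ℕ) : ℝ) ≤ N / B := Nat.cast_div_le
    have h5 : (0 : ℝ) ≤ N / B := by positivity
    have h6 : (k : ℝ) * ((N / B : ℕ) + 2) ≤ ω * (N / B + 2) := by gcongr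
    have h7 : (2 + ω : ℝ) * (moves 0 (p.writes.map (· / B))) ≤ (2 * ω) * (N / B + 2) := by
      gcongr <;> linarith
    nlinarith [mul_nonneg (by linarith : (0 : ℝ) ≤ ω) h5]

theorem cost_copy (hT : Tall K cap B) (hω : 2 ≤ ω) (k s d : ℕ) :
    (copy k s d).CostLE cap ω B (opCost K ω B k) := by
  refine cost_of_scan (k := 1) hT hω (by omega) (fun x => ?_) (by simp [reads_copy])
    (writes_copy k s d)
  rw [reads_copy, List.map_map, one_mul]
  exact moves_scan hT.block_pos s k x

theorem cost_twiddle (hT : Tall K cap B) (hω : 2 ≤ ω) (k m N : ℕ) (e : ℕ → ℕ → ℕ) (s : ℕ) :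
    (twiddle k m N e s).CostLE cap ω B (opCost K ω B (k * m)) := by
  refine cost_of_scan (k := 1) hT hω (by omega) (fun x => ?_) (by simp [reads_twiddle])
    (writes_twiddle k m N e s)
  rw [reads_twiddle, List.map_map, one_mul]
  exact moves_scan hT.block_pos s _ x

theorem cost_bruteDFT (hT : Tall K cap B) (hω : 2 ≤ ω) {k : ℕ} (hk : k ≤ ω) (m s d : ℕ) :
    (bruteDFT k m s d).CostLE cap ω B (opCost K ω B (k * m)) := by
  refine cost_of_scan hT hω hk (fun x => ?_) (by simp [reads_bruteDFT])
    (writes_bruteDFT k m s d)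
  rw [reads_bruteDFT, List.map_flatMap]
  refine moves_flatMap_le (fun i _ x => ?_) x
  rw [List.map_map]
  exact moves_scan hT.block_pos s _ x

theorem cost_transpose (hT : Tall K cap B) (hω : 2 ≤ ω) {p q : ℕ} (hp : 0 < p) (hq : 0 < q)
    (s d : ℕ) : (transpose p q s q d p).CostLE cap ω B (opCost K ω B (p * q)) := by
  have hω' : (2 : ℝ) ≤ ω := by exact_mod_cast hω
  have hB := hT.block_pos
  rcases Nat.lt_or_ge cap 10 with hcap | hcap
  · refine (Prog.CostLE.eachAccess hT.cap_pos _).mono (hT.le_opCost_of_cap_lt hcap ?_)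
    have h3 : (2 : ℝ) * (p * q : ℕ) ≤ ω * (p * q : ℕ) :=
      mul_le_mul_of_nonneg_right hω' (Nat.cast_nonneg _)
    rw [length_reads_transpose, length_writes_transpose]
    linarith
  -- `S` is as large as the two requirements `10 * S ≤ cap` and `S ≤ B` allow. Tallness then says `B
  -- ≤ K * S`, so `N / S` is at most `K * (N / B)`.
  · obtain ⟨S, hS⟩ : ∃ S, S = min (cap / 10) B := ⟨_, rfl⟩
    have hS0 : 0 < S := by omega
    have hSB : S ≤ B := by omega
    have hScap : 10 * S ≤ cap := by omega
    rcases le_or_gt (p * q) (S ^ 2) with h | h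
    · have h1 : p * q / B ≤ S := by
        refine Nat.div_le_of_le_mul (h.trans ?_)
        rw [sq]
        exact Nat.mul_le_mul_right S hSB
      refine (Prog.CostLE.of_within hB (within_transpose p q s d) (by omega)).mono
        (hT.le_opCost ?_)
      have h2 : (0 : ℝ) ≤ (p * q : ℕ) / B := by positivity
      nlinarith
    · refine (cost_transpose_large hB hS0 hSB hScap hp hq (by omega) (.inr rfl)
        (.inr rfl)).mono ?_
      have hB' : (0 : ℝ) < B := by exact_mod_cast hB
      have hS' : (0 : ℝ) < S := by exact_mod_cast hS0
      have h1 : (B : ℝ) ≤ K * S := by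
        rcases le_total (cap / 10) B with h2 | h2
        · rw [min_eq_left h2] at hS
          have := hT.block_le
          rw [← hS, max_eq_right (by exact_mod_cast hS0)] at this
          exact this
        · rw [min_eq_right h2] at hS
          rw [hS]
          exact le_mul_of_one_le_left hB'.le hT.one_le
      have h3 : ((p * q : ℕ) : ℝ) / S ≤ K * ((p * q : ℕ) / B) := by
        rw [← mul_div_assoc, div_le_div_iff₀ hS' hB']
        have : (0 : ℝ) ≤ (p * q : ℕ) := Nat.cast_nonneg _
        nlinarith
      have h4 : (0 : ℝ) ≤ (p * q : ℕ) / S := by positivity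
      have h5 : 0 ≤ K * ω := mul_nonneg (by linarith [hT.one_le]) (by linarith)
      rw [opCost, mul_div_assoc]
      -- Since `ω ≥ 2`, `1 + ω ≤ 3 ω / 2`; this is the origin of the constant `45 = 30 · 3 / 2` in
      -- `opCost`.
      have h6 : (1 + ω : ℝ) * (30 * ((p * q : ℕ) / S)) ≤
          (3 / 2 * ω) * (30 * (K * ((p * q : ℕ) / B))) := by
        gcongr
        linarith
      nlinarith

end Blocks

/-! ### Cost of the algorithm -/

section Recursion

variable {K : ℝ} {cap ω B : ℕ}

/-- Subproblems of size `n` fit into the cache. -/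
def Fits (cap B n : ℕ) : Prop := 10 ≤ cap ∧ n ≤ B * (cap / 2 - 2)

/-- Serving the subproblems one by one would pay the additive `O(ω)` for every one of them, too much
when `n` is below `B`. Consecutive subproblems are instead grouped so that a group just fits into
the cache. A full group spans at least `3 B / 2` words, to which its additive term is charged. -/
theorem cost_parFor_of_fits (hT : Tall K cap B) (hω : 2 ≤ ω) {n : ℕ} (hn : 0 < n)
    (hf : Fits cap B n) (k : ℕ) : ∀ {a t : ℕ} {body : ℕ → Prog},
    (∀ i < k, (body i).Within (a + i * n) (t + i * n) n) →
    (Prog.parFor k body).CostLE cap ω B (opCost K ω B (k * n)) := by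
  have hω' : (2 : ℝ) ≤ ω := by exact_mod_cast hω
  have hB := hT.block_pos
  have hB' : (0 : ℝ) < B := by exact_mod_cast hB
  obtain ⟨hcap, hG⟩ := hf
  obtain ⟨G, hGdef⟩ : ∃ G, G = B * (cap / 2 - 2) := ⟨_, rfl⟩
  obtain ⟨g, hg⟩ : ∃ g, g = G / n := ⟨_, rfl⟩
  have hg0 : 0 < g := hg ▸ Nat.div_pos (hGdef ▸ hG) hn
  have hgG : g * n ≤ G := hg ▸ Nat.div_mul_le_self G n
  have hG3 : B * 3 ≤ G := hGdef ▸ Nat.mul_le_mul_left B (by omega)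
  have hgn : B * 3 ≤ 2 * (g * n) := by
    have h1 : G < (g + 1) * n := by
      rw [hg, add_mul, one_mul, mul_comm]; exact Nat.lt_mul_div_succ G hn
    have h2 : n ≤ g * n := Nat.le_mul_of_pos_left n hg0
    rw [add_mul] at h1
    omega
  have few {k a t : ℕ} {body : ℕ → Prog} (hk : k ≤ g)
      (h : ∀ i < k, (body i).Within (a + i * n) (t + i * n) n) :
      (Prog.parFor k body).CostLE cap ω B ((1 + ω) * (2 * ((k * n : ℕ) / B + 2))) := by
    refine Prog.CostLE.of_within hB (Prog.within_parFor h) ?_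
    have h1 : k * n / B ≤ cap / 2 - 2 := by
      refine Nat.div_le_of_le_mul ?_
      rw [← hGdef]
      exact (Nat.mul_le_mul_right n hk).trans hgG
    omega
  suffices key : ∀ k {a t : ℕ} {body : ℕ → Prog},
      (∀ i < k, (body i).Within (a + i * n) (t + i * n) n) →
      (Prog.parFor k body).CostLE cap ω B ((1 + ω) * (12 * ((k * n : ℕ) / B) + 4)) by
    intro a t body h
    refine (key k h).mono (hT.le_opCost ?_)
    have : (0 : ℝ) ≤ (k * n : ℕ) / B := by positivity
    nlinarith
  intro k
  induction k using Nat.strong_induction_on with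
  | _ k ih =>
    intro a t body h
    have h0 : (0 : ℝ) ≤ (k * n : ℕ) / B := by positivity
    rcases le_or_gt k g with hk | hk
    · exact (few hk h).mono (mul_le_mul_of_nonneg_left (by linarith) (by positivity))
    · obtain ⟨k', rfl⟩ := Nat.exists_eq_add_of_lt hk
      rw [add_assoc] at h ⊢
      have h1 := ih (k' + 1) (by omega) (a := a + g * n) (t := t + g * n)
        (body := fun i => body (g + i)) fun i hi => by
          have := h (g + i) (by omega)
          rwa [add_mul, ← add_assoc, ← add_assoc] at this
      refine ((few le_rfl fun i hi => h i (by omega)).parFor_add h1).mono ?_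
      have h2 : (3 : ℝ) ≤ 2 * ((g * n : ℕ) / B) := by
        rw [← mul_div_assoc, le_div_iff₀ hB', mul_comm]
        exact_mod_cast hgn
      have h3 : (((g + (k' + 1)) * n : ℕ) : ℝ) / B =
          (g * n : ℕ) / B + ((k' + 1) * n : ℕ) / B := by
        rw [add_mul, Nat.cast_add, add_div]
      rw [h3, ← mul_add]
      exact mul_le_mul_of_nonneg_left (by linarith) (by positivity)

theorem cost_fftLoop_of_forall {m : ℕ} {x : ℝ} (h : ∀ a t, (fft ω m a t).CostLE cap ω B x)
    (k a t : ℕ) : (fftLoop ω k m a t).CostLE cap ω B (k * x) :=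
  Prog.CostLE.parFor fun _ _ => h _ _

theorem cost_fftRow (hT : Tall K cap B) (hω : 2 ≤ ω) {m : ℕ} (hm : 0 < m) {x : ℝ}
    (h : ∀ a t, (fftLoop ω ω m a t).CostLE cap ω B x) (n r a t : ℕ) :
    (fftRow ω m n r a t).CostLE cap ω B (5 * opCost K ω B (ω * m) + x) := by
  have ht := cost_transpose (cap := cap) hT hω (by omega : 0 < ω) hm t a
  refine (ht.seq <| (cost_bruteDFT hT hω le_rfl m a t).seq <|
    (cost_twiddle hT hω ω m _ _ t).seq <| (h t a).seq <|
    (cost_twiddle hT hω ω m _ _ t).seq ht).mono ?_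
  linarith

theorem cost_fft_step (hT : Tall K cap B) (hω : 2 ≤ ω) {m : ℕ} (hm : 2 ≤ m) {x y : ℝ}
    (h : ∀ a t, (fftLoop ω ω m a t).CostLE cap ω B x)
    (h' : ∀ a t, (fftLoop ω (ω * m) m a t).CostLE cap ω B y) (a t : ℕ) :
    (fft ω (ω * m ^ 2) a t).CostLE cap ω B
      (3 * opCost K ω B (ω * m ^ 2) + m * (5 * opCost K ω B (ω * m) + x) + y) := by
  have hm0 : 0 < m := by omega
  have hl : 0 < ω * m := by positivity
  have e1 : ω * m ^ 2 = ω * m * m := by ring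
  have e2 : ω * m ^ 2 = m * (ω * m) := by ring
  have h1 := cost_transpose (cap := cap) hT hω hl hm0 a t
  have h2 := cost_transpose (cap := cap) hT hω hm0 hl a t
  have h3 := cost_transpose (cap := cap) hT hω hl hm0 t a
  rw [← e1] at h1 h3
  rw [← e2] at h2
  rw [fft_step (by omega) hm]
  refine (h1.seq <| (Prog.CostLE.parFor fun r _ => cost_fftRow hT hω hm0 h _ _ _ _).seq <|
    h2.seq <| (h' t a).seq h3).mono ?_
  linarith

/-- Once `N` is at least `κ B`, the additive `1` in `opCost` is at most `(N / B) / κ`. -/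
theorem opCost_le (hT : Tall K cap B) {κ : ℝ} (hκ : 0 < κ) {N : ℕ} (hN : κ * B ≤ N) :
    opCost K ω B N ≤ ω * (N / B) * (45 * K * (1 + 1 / κ)) := by
  have hB' : (0 : ℝ) < B := by exact_mod_cast hT.block_pos
  have h1 : 1 ≤ N / B * (1 / κ) := by
    rw [mul_one_div, le_div_iff₀ hκ, one_mul, le_div_iff₀ hB']
    exact hN
  have h2 : (0 : ℝ) ≤ 45 * K * ω := mul_nonneg (by linarith [hT.one_le]) (Nat.cast_nonneg _)
  rw [opCost]
  nlinarith

/-- The cost of a loop over contiguous subproblems. Here `X` measures the depth of the recursion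
and is bounded below on the problems that do not fit into the cache. -/
theorem cost_fftLoop (hT : Tall K cap B) (hω : 2 ≤ ω) {κ lam : ℝ} {X : ℕ → ℝ} (hκ : 0 < κ)
    (hlam : 0 < lam) (hX : ∀ m, 0 < m → X (ω * m ^ 2) = 2 * X m)
    (hlarge : ∀ n, 0 < n → ¬ Fits cap B n → (κ * B) ^ 2 ≤ n ∧ lam ≤ X n) {P A : ℝ}
    (hP : P = 45 * K * (1 + 1 / κ)) (hA : A = 20 * P / lam) {n : ℕ} (hn : FFTSize ω n) :
    lam / 2 ≤ X n → ∀ k a t : ℕ, κ * B ≤ (k * n : ℕ) →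
      (fftLoop ω k n a t).CostLE cap ω B (ω * ((k * n : ℕ) / B) * (A * X n - 8 * P)) := by
  have hω0 : 0 < ω := by omega
  have hB' : (0 : ℝ) < B := by exact_mod_cast hT.block_pos
  have hκB : 0 < κ * B := mul_pos hκ hB'
  have hP0 : 0 < P := by
    have := hT.one_le
    rw [hP]; positivity
  -- The choice of `A` gives `A * lam / 2 = 10 P`. The slack `2 P` pays for the base cases: one `P`
  -- for a loop that fits, two for brute force followed by a copy.
  have hAX : ∀ n, lam / 2 ≤ X n → 2 * P ≤ A * X n - 8 * P := by
    intro n hn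
    have h1 : A * (lam / 2) = 10 * P := by rw [hA]; field_simp; norm_num
    have h2 : 0 ≤ A := by rw [hA]; positivity
    nlinarith [mul_le_mul_of_nonneg_left hn h2]
  have hop {N : ℕ} (hN : κ * B ≤ N) : opCost K ω B N ≤ ω * (N / B) * P :=
    hP ▸ opCost_le hT hκ hN
  have hle {n : ℕ} (hn : 0 < n) (h : (κ * B) ^ 2 ≤ n) : κ * B ≤ n := by
    have h1 : (1 : ℝ) ≤ n := by exact_mod_cast hn
    by_contra! hlt
    nlinarith
  have fits {n : ℕ} (hn : FFTSize ω n) (hf : Fits cap B n) (hXn : lam / 2 ≤ X n) (k a t : ℕ)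
      (hk : κ * B ≤ (k * n : ℕ)) :
      (fftLoop ω k n a t).CostLE cap ω B (ω * ((k * n : ℕ) / B) * (A * X n - 8 * P)) := by
    refine (cost_parFor_of_fits hT hω (hn.pos hω0) hf k (a := a) (t := t)
      fun i _ => within_fft hω0 hn _ _).mono ((hop hk).trans ?_)
    exact mul_le_mul_of_nonneg_left (by linarith [hAX n hXn]) (by positivity)
  have cast_mul_div (k n : ℕ) (z : ℝ) :
      (k : ℝ) * (ω * ((n : ℝ) / B) * z) = ω * ((k * n : ℕ) / B) * z := by
    push_cast; ring
  refine hn.recOn' hω0 (motive := fun n => lam / 2 ≤ X n → ∀ k a t : ℕ, κ * B ≤ (k * n : ℕ) →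
      (fftLoop ω k n a t).CostLE cap ω B (ω * ((k * n : ℕ) / B) * (A * X n - 8 * P))) ?_ ?_
  · intro n hn0 hnω hXn k a t hk
    by_cases hf : Fits cap B n
    · refine (cost_parFor_of_fits hT hω hn0 hf k (a := a) (t := t) fun i _ => ?_).mono
        ((hop hk).trans ?_)
      · rw [fft_of_le hnω]
        refine Prog.Within.seq ?_ (within_copy _ _ _).symm
        simpa using within_bruteDFT n 1 (a + i * n) (t + i * n)
      · exact mul_le_mul_of_nonneg_left (by linarith [hAX n hXn]) (by positivity)
    · have h1 := hop (hle hn0 (hlarge n hn0 hf).1)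
      rw [← cast_mul_div]
      refine cost_fftLoop_of_forall (fun a t => ?_) k a t
      rw [fft_of_le hnω]
      have h2 := cost_bruteDFT (cap := cap) hT hω hnω 1 a t
      rw [mul_one] at h2
      refine (h2.seq (cost_copy hT hω n t a)).mono ?_
      have := mul_le_mul_of_nonneg_left (hAX n hXn)
        (by positivity : (0 : ℝ) ≤ ω * ((n : ℝ) / B))
      linarith
  · intro m hm hs ih hXn k a t hk
    have hm0 : 0 < m := by omega
    have hs' : FFTSize ω (ω * m ^ 2) := .step m hs
    have hn0 := hs'.pos hω0
    by_cases hf : Fits cap B (ω * m ^ 2)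
    · exact fits hs' hf hXn k a t hk
    · obtain ⟨h1, h2⟩ := hlarge _ hn0 hf
      have hn := hle hn0 h1
      -- This allows the induction hypothesis to be applied to the `ω` subproblems of one row: `(κ
      -- B)² ≤ ω m² ≤ (ω m)²`.
      have hl : κ * B ≤ (ω * m : ℕ) := by
        have h3 : ω * m ^ 2 ≤ (ω * m) ^ 2 := by
          rw [mul_pow]; exact Nat.mul_le_mul_right _ (Nat.le_self_pow two_ne_zero ω)
        have h4 : ((ω * m ^ 2 : ℕ) : ℝ) ≤ ((ω * m : ℕ) : ℝ) ^ 2 := by exact_mod_cast h3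
        exact (sq_le_sq₀ hκB.le (Nat.cast_nonneg _)).1 (h1.trans h4)
      -- A problem that does not fit has `lam ≤ X n = 2 X m`, so the weaker hypothesis `lam / 2`
      -- holds for `m`, even if subproblems of size `m` fit.
      rw [hX m hm0] at h2 hXn ⊢
      specialize ih (by linarith)
      rw [← cast_mul_div]
      have e1 : ω * m * m = ω * m ^ 2 := by ring
      refine cost_fftLoop_of_forall (fun a t => (cost_fft_step hT hω hm
        (fun a t => ih ω a t hl) (fun a t => ih (ω * m) a t (e1 ▸ hn)) a t).mono ?_) k a t
      have h5 := hop hn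
      have h6 := mul_le_mul_of_nonneg_left (hop hl) (Nat.cast_nonneg (α := ℝ) m)
      have e2 : (m : ℝ) * (ω * ((ω * m : ℕ) / B) * P) = ω * ((ω * m ^ 2 : ℕ) / B) * P := by
        push_cast; ring
      have e3 : (m : ℝ) * (ω * ((ω * m : ℕ) / B) * (A * X m - 8 * P)) =
          ω * ((ω * m ^ 2 : ℕ) / B) * (A * X m - 8 * P) := by
        push_cast; ring
      rw [e2] at h6
      -- In units of `ω n / B` the step costs `3 P + 5 P + 2 (A X m - 8 P) = A (2 X m) - 8 P`; the
      -- term `-8 P` reproduces itself.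
      rw [mul_add, e3, e1]
      linarith

end Recursion

/-! ### The constants -/

/-- From `c B² ≤ M < B (M / B + 1)` it follows that `c B ≤ M / B + 1`, and rounding to tenths costs
at most a factor `20`. -/
theorem tall_of_le {c : ℝ} (hc : 0 < c) {M B : ℕ} (hB : 1 ≤ B) (hBM : B ≤ M)
    (h : c * (B : ℝ) ^ 2 ≤ M) : Tall (max 1 (40 / c)) (M / B) B := by
  have hB' : (0 : ℝ) < B := by exact_mod_cast hB
  have hcap : 1 ≤ M / B := (Nat.one_le_div_iff hB).2 hBM
  refine ⟨le_max_left _ _, hB, hcap, ?_⟩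
  obtain ⟨g, hg⟩ : ∃ g, g = max 1 (M / B / 10) := ⟨_, rfl⟩
  rw [← hg]
  have h1 : M / B + 1 ≤ 20 * g := by omega
  have h2 : (M : ℝ) < B * ((M / B : ℕ) + 1) := by
    exact_mod_cast Nat.lt_mul_div_succ M hB
  have h3 : ((M / B : ℕ) : ℝ) + 1 ≤ 20 * g := by exact_mod_cast h1
  have h4 : c * B ≤ 20 * g := by
    refine le_trans ?_ h3
    by_contra! hlt
    nlinarith
  calc (B : ℝ) ≤ 40 / c * g := by
        rw [div_mul_eq_mul_div, le_div_iff₀ hc]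
        linarith
    _ ≤ _ := mul_le_mul_of_nonneg_right (le_max_right _ _) (Nat.cast_nonneg _)

/-- With fewer than ten blocks, `M < 10 B` and `c B < 10`, so `c M / 100 < 1 ≤ n`. Otherwise `n > B
(cap / 2 - 2)` with `cap = M / B`, and `cap + 1 ≤ 5 (cap / 2 - 2)` gives `M ≤ 5 n`. -/
theorem le_of_not_fits {c : ℝ} {M B n : ℕ} (hB : 1 ≤ B) (hn : 0 < n)
    (h : c * (B : ℝ) ^ 2 ≤ M) (hf : ¬ Fits (M / B) B n) : min (1 / 5) (c / 100) * M ≤ n := by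
  have hB' : (0 : ℝ) < B := by exact_mod_cast hB
  have hM : (0 : ℝ) ≤ M := Nat.cast_nonneg M
  have h2 : M < B * (M / B + 1) := Nat.lt_mul_div_succ M hB
  rcases Nat.lt_or_ge (M / B) 10 with hcap | hcap
  · have h3 : (M : ℝ) < B * 10 := by
      exact_mod_cast h2.trans_le (Nat.mul_le_mul_left B (by omega))
    have h4 : c * B < 10 := by
      by_contra! hlt
      nlinarith
    have h5 : (1 : ℝ) ≤ n := by exact_mod_cast hn
    refine le_trans (mul_le_mul_of_nonneg_right (min_le_right _ _) hM) ?_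
    nlinarith
  · have h3 : B * (M / B / 2 - 2) < n := by
      by_contra! hlt
      exact hf ⟨hcap, hlt⟩
    have h4 : B * (M / B + 1) ≤ B * (5 * (M / B / 2 - 2)) := Nat.mul_le_mul_left B (by omega)
    rw [mul_left_comm] at h4
    have h5 : (M : ℝ) ≤ 5 * n := by exact_mod_cast (by omega : M ≤ 5 * n)
    refine le_trans (mul_le_mul_of_nonneg_right (min_le_left _ _) hM) ?_
    linarith

/-- `log (ω M)` exceeds `log (ω n)` by at most `log (1 / α)`, which is at most a constant multiple
of `log (ω n)` because `ω n ≥ 2`. -/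
theorem le_logb_of_le {α : ℝ} (hα : 0 < α) (hα1 : α ≤ 1) {ω M n : ℕ} (hω : 2 ≤ ω) (hM : 1 ≤ M)
    (hn : 0 < n) (h : α * M ≤ n) :
    1 / (1 + Real.log (1 / α) / Real.log 2) ≤ Real.logb (ω * M) (ω * n) := by
  have hω' : (2 : ℝ) ≤ ω := by exact_mod_cast hω
  have hM' : (1 : ℝ) ≤ M := by exact_mod_cast hM
  have hn' : (1 : ℝ) ≤ n := by exact_mod_cast hn
  have hlog2 : 0 < Real.log 2 := Real.log_pos (by norm_num)
  have hlogα : 0 ≤ Real.log (1 / α) := Real.log_nonneg (by rw [le_div_iff₀ hα]; linarith)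
  have h1 : 0 < Real.log (ω * M) := Real.log_pos (by nlinarith)
  have h2 : Real.log 2 ≤ Real.log (ω * n) := Real.log_le_log (by norm_num) (by nlinarith)
  have h3 : Real.log (ω * M) ≤ Real.log (ω * n) + Real.log (1 / α) := by
    rw [← Real.log_mul (by positivity) (by positivity)]
    refine Real.log_le_log (by positivity) ?_
    rw [mul_one_div, le_div_iff₀ hα]
    nlinarith
  have h4 : Real.log (1 / α) ≤ Real.log (1 / α) / Real.log 2 * Real.log (ω * n) := by
    rw [div_mul_eq_mul_div, le_div_iff₀ hlog2]
    exact mul_le_mul_of_nonneg_left h2 hlogα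
  rw [Real.logb, div_le_div_iff₀ (by positivity) h1]
  linarith

theorem logb_step (ω M m : ℕ) :
    Real.logb (ω * M) (ω * (ω * m ^ 2 : ℕ)) = 2 * Real.logb (ω * M) (ω * m) := by
  have : (ω : ℝ) * (ω * m ^ 2 : ℕ) = (ω * m) ^ 2 := by push_cast; ring
  rw [this, Real.logb_pow]
  norm_num

/-- The optimal cost of the algorithm under the tall-cache assumption. -/
theorem exists_costLE_fft {c : ℝ} (hc : 0 < c) : ∃ C : ℝ, ∀ ω n M B : ℕ, 2 ≤ ω → FFTSize ω n →
    1 ≤ B → B ≤ M → c * (B : ℝ) ^ 2 ≤ M → ∃ x, (fft ω n 0 n).CostLE (M / B) ω B (ω * x) ∧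
      (M ≤ n → x ≤ C * ((n / B) * Real.logb (ω * M) (ω * n))) ∧
      (n ≤ M → x ≤ C * ⌈(n : ℝ) / B⌉₊) := by
  obtain ⟨K, hK⟩ : ∃ K, K = max 1 (40 / c) := ⟨_, rfl⟩
  obtain ⟨α, hα⟩ : ∃ α, α = min (1 / 5) (c / 100) := ⟨_, rfl⟩
  have hα0 : 0 < α := hα ▸ lt_min (by norm_num) (by positivity)
  have hα1 : α ≤ 1 := by
    have : α ≤ 1 / 5 := hα ▸ min_le_left _ _
    linarith
  obtain ⟨lam, hlam⟩ : ∃ l, l = 1 / (1 + Real.log (1 / α) / Real.log 2) := ⟨_, rfl⟩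
  have hlam0 : 0 < lam := by
    have h1 : 0 < Real.log 2 := Real.log_pos (by norm_num)
    have h2 : 0 ≤ Real.log (1 / α) := Real.log_nonneg (by rw [le_div_iff₀ hα0]; linarith)
    rw [hlam]; positivity
  -- As `κ ≤ 1`, `κ² ≤ α c`; problems that do not fit then satisfy `(κ B)² ≤ α c B² ≤ α M ≤ n`.
  obtain ⟨κ, hκ⟩ : ∃ κ, κ = min 1 (α * c) := ⟨_, rfl⟩
  have hκ0 : 0 < κ := hκ ▸ lt_min one_pos (by positivity)
  have hκ2 : κ ^ 2 ≤ α * c := by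
    have h1 : κ ≤ 1 := hκ ▸ min_le_left _ _
    have h2 : κ ≤ α * c := hκ ▸ min_le_right _ _
    nlinarith
  obtain ⟨P, hP⟩ : ∃ P, P = 45 * K * (1 + 1 / κ) := ⟨_, rfl⟩
  obtain ⟨A, hA⟩ : ∃ A, A = 20 * P / lam := ⟨_, rfl⟩
  have hK1 : 1 ≤ K := hK ▸ le_max_left _ _
  have hP0 : 0 < P := by rw [hP]; positivity
  have hA0 : 0 < A := by rw [hA]; positivity
  refine ⟨A + 90 * K, fun ω n M B hω hn hB hBM hM => ?_⟩
  have hω0 : 0 < ω := by omega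
  have hω' : (2 : ℝ) ≤ ω := by exact_mod_cast hω
  have hM1 : 1 ≤ M := hB.trans hBM
  have hM' : (1 : ℝ) ≤ M := by exact_mod_cast hM1
  have hB' : (0 : ℝ) < B := by exact_mod_cast hB
  have hn0 := hn.pos hω0
  have hn' : (0 : ℝ) < n := by exact_mod_cast hn0
  have hT : Tall K (M / B) B := hK ▸ tall_of_le hc hB hBM hM
  have hnB : (0 : ℝ) < n / B := by positivity
  have hceil : (n : ℝ) / B ≤ ⌈(n : ℝ) / B⌉₊ := Nat.le_ceil _
  have hceil1 : (1 : ℝ) ≤ ⌈(n : ℝ) / B⌉₊ := by exact_mod_cast Nat.ceil_pos.2 hnB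
  have single {x : ℝ} (h : (Prog.parFor 1 fun i => fft ω n (0 + i * n) (n + i * n)).CostLE
      (M / B) ω B x) : (fft ω n 0 n).CostLE (M / B) ω B x := by
    simpa [Prog.CostLE, Prog.blockTrace, Prog.trace] using h
  have hbase : 1 < (ω : ℝ) * M := by nlinarith
  -- The summand `90 K` of the constant covers problems that fit, the summand `A` the others. A
  -- problem may fail to fit although `n ≤ M`; then the logarithm is at most `1`.
  by_cases hf : Fits (M / B) B n
  · refine ⟨45 * K * (n / B + 1), single ?_, fun hMn => ?_, fun _ => ?_⟩
    · have := cost_parFor_of_fits hT hω hn0 hf 1 (a := 0) (t := n)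
        fun i _ => within_fft hω0 hn (0 + i * n) (n + i * n)
      refine this.mono (le_of_eq ?_)
      rw [opCost, one_mul]
      ring
    · have h1 : 1 ≤ Real.logb (ω * M) (ω * n) := by
        rw [Real.le_logb_iff_rpow_le hbase (by positivity), Real.rpow_one]
        have : (M : ℝ) ≤ n := by exact_mod_cast hMn
        gcongr
      have h2 : (1 : ℝ) ≤ n / B := by
        rw [le_div_iff₀ hB', one_mul]
        exact_mod_cast hBM.trans hMn
      have h3 : (n : ℝ) / B ≤ n / B * Real.logb (ω * M) (ω * n) :=
        le_mul_of_one_le_right hnB.le h1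
      calc 45 * K * (n / B + 1) ≤ 45 * K * (2 * (n / B * Real.logb (ω * M) (ω * n))) := by
            gcongr; linarith
        _ ≤ A * (n / B * Real.logb (ω * M) (ω * n)) +
            45 * K * (2 * (n / B * Real.logb (ω * M) (ω * n))) := by
            refine le_add_of_nonneg_left (mul_nonneg hA0.le (hnB.le.trans h3))
        _ = _ := by ring
    · calc 45 * K * (n / B + 1) ≤ 45 * K * (2 * ⌈(n : ℝ) / B⌉₊) := by
            gcongr; linarith
        _ ≤ A * ⌈(n : ℝ) / B⌉₊ + 45 * K * (2 * ⌈(n : ℝ) / B⌉₊) :=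
            le_add_of_nonneg_left (by positivity)
        _ = _ := by ring
  · have hlarge : ∀ n, 0 < n → ¬ Fits (M / B) B n →
        (κ * B) ^ 2 ≤ n ∧ lam ≤ Real.logb (ω * M) (ω * n) := by
      intro n hn0 hf
      have h1 : α * M ≤ n := hα ▸ le_of_not_fits hB hn0 hM hf
      refine ⟨?_, hlam ▸ le_logb_of_le hα0 hα1 hω hM1 hn0 h1⟩
      calc (κ * B) ^ 2 = κ ^ 2 * (B : ℝ) ^ 2 := by ring
        _ ≤ α * c * (B : ℝ) ^ 2 := mul_le_mul_of_nonneg_right hκ2 (by positivity)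
        _ = α * (c * (B : ℝ) ^ 2) := by ring
        _ ≤ α * M := mul_le_mul_of_nonneg_left hM hα0.le
        _ ≤ n := h1
    obtain ⟨h1, h2⟩ := hlarge n hn0 hf
    have h3 : κ * B ≤ (1 * n : ℕ) := by
      have : (1 : ℝ) ≤ n := by exact_mod_cast hn0
      rw [one_mul]
      by_contra! hlt
      nlinarith [mul_pos hκ0 hB']
    have h4 := cost_fftLoop hT hω (X := fun n => Real.logb (ω * M) (ω * n)) hκ0 hlam0
      (fun m _ => logb_step ω M m) hlarge hP hA hn (by linarith) 1 0 n h3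
    rw [one_mul] at h4
    have h5 : n / B * (A * Real.logb (ω * M) (ω * n) - 8 * P) ≤
        A * (n / B * Real.logb (ω * M) (ω * n)) := by nlinarith
    have h6 : 0 < n / B * Real.logb (ω * M) (ω * n) := mul_pos hnB (hlam0.trans_le h2)
    refine ⟨_, (single h4).mono (le_of_eq (mul_assoc _ _ _)), fun _ => ?_, fun hnM => ?_⟩
    · nlinarith
    · have h7 : Real.logb (ω * M) (ω * n) ≤ 1 := by
        rw [Real.logb_le_iff_le_rpow hbase (by positivity), Real.rpow_one]
        have : (n : ℝ) ≤ M := by exact_mod_cast hnM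
        gcongr
      have h8 : n / B * Real.logb (ω * M) (ω * n) ≤ n / B := mul_le_of_le_one_right hnB.le h7
      have h9 := mul_le_mul_of_nonneg_left (h8.trans hceil) hA0.le
      nlinarith

/-! ### Optimal policies -/

/-- Total costs are natural numbers and some run exists, so a minimum is attained. -/
theorem exists_idealCost {ω M B : ℕ} {p : Prog} {x : ℝ} (h : p.CostLE (M / B) ω B x) :
    ∃ r w, IdealCost ω M B p r w := by
  classical
  obtain ⟨r, w, h1, -⟩ := AsymFFT.CostLE.exists_run h
  have hex : ∃ z, ∃ r w, CacheRun (M / B) ∅ ∅ (p.blockTrace B) r w ∧ r + ω * w = z :=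
    ⟨_, r, w, h1, rfl⟩
  obtain ⟨r, w, h2, h3⟩ := Nat.find_spec hex
  exact ⟨r, w, h2, fun r' w' h' => h3.trans_le (Nat.find_min' hex ⟨r', w', h', rfl⟩)⟩

theorem IdealCost.le {ω M B : ℕ} {p : Prog} {x : ℝ} {r w : ℕ} (hi : IdealCost ω M B p r w)
    (h : p.CostLE (M / B) ω B x) : (r : ℝ) + ω * w ≤ x := by
  obtain ⟨r', w', h1, h2⟩ := AsymFFT.CostLE.exists_run h
  have h3 : ((r + ω * w : ℕ) : ℝ) ≤ (r' + ω * w' : ℕ) := by exact_mod_cast hi.2 r' w' h1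
  push_cast at h3
  linarith

end AsymFFT

/-- The write cost is `ω = 2 ^ b > 1`. The input is stored in the words `0, …, n - 1`, which hold
the output at the end; the words `n, …, 2 n - 1` are workspace with arbitrary initial contents. -/
theorem mainTheorem9 :
    -- the program has no races and computes the DFT
    (∀ ω b n : ℕ, 1 ≤ b → ω = 2 ^ b → AsymFFT.FFTSize ω n →
      (AsymFFT.fft ω n 0 n).RaceFree ∧
      ∀ [NeZero n] (mem : ℕ → ℂ) (k : ZMod n),
        (AsymFFT.fft ω n 0 n).exec mem k.val =
          ZMod.dft (fun j : ZMod n => mem j.val) k) ∧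
    -- depth `O(ω log n log log n)`
    (∃ C : ℝ, ∀ ω b n : ℕ, 1 ≤ b → ω = 2 ^ b → AsymFFT.FFTSize ω n → 4 ≤ n →
      ((AsymFFT.fft ω n 0 n).depth ω : ℝ) ≤
        C * (ω * Real.logb 2 n * Real.logb 2 (Real.logb 2 n))) ∧
    -- block reads and writes under the tall-cache assumption `M = Ω(B²)`
    (∀ c : ℝ, 0 < c → ∃ C : ℝ, ∀ ω b n M B : ℕ, 1 ≤ b → ω = 2 ^ b → AsymFFT.FFTSize ω n →
      1 ≤ B → B ≤ M → c * (B : ℝ) ^ 2 ≤ M →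
      (∃ r w : ℕ, AsymFFT.IdealCost ω M B (AsymFFT.fft ω n 0 n) r w) ∧
      ∀ r w : ℕ, AsymFFT.IdealCost ω M B (AsymFFT.fft ω n 0 n) r w →
        (M ≤ n →
          (r : ℝ) ≤ C * ((ω * n / B) * Real.logb (ω * M) (ω * n)) ∧
          (w : ℝ) ≤ C * ((n / B) * Real.logb (ω * M) (ω * n))) ∧
        (n ≤ M →
          (r : ℝ) ≤ C * (ω * ⌈(n : ℝ) / B⌉₊) ∧
          (w : ℝ) ≤ C * ⌈(n : ℝ) / B⌉₊)) := by

  have two_le {ω b : ℕ} (hb : 1 ≤ b) (h : ω = 2 ^ b) : 2 ≤ ω :=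
    h ▸ Nat.le_self_pow (by omega) 2
  refine ⟨fun ω b n hb hω hn => ?_, ⟨51, fun ω b n hb hω hn h4 => ?_⟩, fun c hc => ?_⟩
  · have hω0 : 0 < ω := lt_of_lt_of_le zero_lt_two (two_le hb hω)
    exact ⟨AsymFFT.raceFree_fft hω0 hn 0 n (by omega),
      fun mem k => AsymFFT.exec_fft_eq_dft hω0 hn mem k⟩
  · exact AsymFFT.depth_fft_le_log_mul_log_log (two_le hb hω) hn h4 0 n
  · obtain ⟨C, hC⟩ := AsymFFT.exists_costLE_fft hc
    refine ⟨C, fun ω b n M B hb hω hn hB hBM hM => ?_⟩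
    obtain ⟨x, hx, h1, h2⟩ := hC ω n M B (two_le hb hω) hn hB hBM hM
    refine ⟨AsymFFT.exists_idealCost hx, fun r w hi => ?_⟩
    have hω' : (0 : ℝ) < ω := by
      exact_mod_cast lt_of_lt_of_le zero_lt_two (two_le hb hω)
    have h3 := hi.le hx
    -- The combined bound `r + ω w ≤ ω x` is split by dropping one nonnegative summand at a time.
    have hr : (r : ℝ) ≤ ω * x := by
      have : (0 : ℝ) ≤ ω * w := by positivity
      linarith
    have hw : (w : ℝ) ≤ x := by
      have : (0 : ℝ) ≤ r := Nat.cast_nonneg r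
      exact le_of_mul_le_mul_left (by linarith) hω'
    refine ⟨fun h => ⟨hr.trans ?_, hw.trans (h1 h)⟩, fun h => ⟨hr.trans ?_, hw.trans (h2 h)⟩⟩
    · refine (mul_le_mul_of_nonneg_left (h1 h) hω'.le).trans (le_of_eq ?_)
      ring
    · refine (mul_le_mul_of_nonneg_left (h2 h) hω'.le).trans (le_of_eq ?_)
      ring
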